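/- A permutation $\sigma$ of size $|\sigma| = n$ is a bijection from $\{1,\dots,n\}$ onto itself, written as the word $\sigma_1\sigma_2\cdots\sigma_n$ with $\sigma_i=\sigma(i)$. A permutation $\pi=\pi_1\cdots\pi_k$ is a pattern of $\sigma$, written $\pi\preceq\sigma$, if there are indices $i_1<\dots<i_k$ such that $\pi$ is order-isomorphic to $\sigma_{i_1}\cdots\sigma_{i_k}$. An interval of $\sigma$ is a nonempty block of consecutive entries $\sigma_i\sigma_{i+1}\cdots\sigma_j$ whose set of values is an interval of integers, and $\sigma$ is simple if its only intervals are the singletons and the whole permutation. A permutation is exceptional if, for some $m\ge 2$, it is one of the following permutations of size $2m$: 1. $2\ 4\ 6\ \cdots\ (2m)\ 1\ 3\ 5\ \cdots\ (2m-1)$, 2. $(2m-1)\ (2m-3)\ \cdots\ 1\ (2m)\ (2m-2)\ \cdots\ 2$, 3. $(m+1)\ 1\ (m+2)\ 2\ \cdots\ (2m)\ m$, 4. $m\ (2m)\ (m-1)\ (2m-1)\ \cdots\ 1\ (m+1)$. **Theorem.** Let $\sigma\neq\pi$ be simple permutations such that $\sigma$ is not exceptional, $\pi\preceq\sigma$ and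 $|\pi|\ge 3$, and let $\ell=|\sigma|-|\pi|$. Then there is a chain of simple permutations $\sigma^{(0)}=\sigma,\ \sigma^{(1)},\ \dots,\ \sigma^{(\ell)}=\pi$ such that, for every $1\le i\le\ell$, $\sigma^{(i)}\preceq\sigma^{(i-1)}$ and $|\sigma^{(i-1)}|-|\sigma^{(i)}|=1$. (The permutation $\pi$ may be exceptional.) -/

import Mathlib

/-- A permutation together with its size `n`. Positions and values are both numbered from `0`,
so a permutation of `{1, …, n}` with word `w₁ … wₙ` sends the position `i - 1` to `wᵢ - 1`. -/
abbrev FinPerm : Type := Σ n : ℕ, Equiv.Perm (Fin n)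

namespace FinPerm

/-- The size `|σ|` of a permutation. -/
abbrev size (σ : FinPerm) : ℕ := σ.1

/-- `π` is a pattern of `σ` (`π ≼ σ`): there are positions `i₁ < … < iₖ` of `σ`, `k = |π|`, such
that `π` is order-isomorphic to the word `σ(i₁) … σ(iₖ)`. -/
def IsPattern (π σ : FinPerm) : Prop :=
  ∃ f : Fin π.size → Fin σ.size, StrictMono f ∧
    ∀ a b : Fin π.size, π.2 a < π.2 b ↔ σ.2 (f a) < σ.2 (f b)

/-- The consecutive positions `a, a + 1, …, b` form an interval of `σ`: the set of values taken
at these positions is an interval of integers. -/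
def IsInterval (σ : FinPerm) (a b : Fin σ.size) : Prop :=
  ∃ c d : Fin σ.size, σ.2 '' Set.Icc a b = Set.Icc c d

/-- `σ` is simple: its only intervals are the singletons and the whole permutation. -/
def IsSimple (σ : FinPerm) : Prop :=
  ∀ a b : Fin σ.size, a ≤ b → σ.IsInterval a b → a = b ∨ Set.Icc a b = Set.univ

/-- Type 1 of size `2m`, with word `2 4 6 … (2m) 1 3 5 … (2m-1)`. -/
def IsExceptionalType1 (m : ℕ) (σ : FinPerm) : Prop :=
  σ.size = 2 * m ∧ ∀ i : Fin σ.size,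
    ((i : ℕ) < m → (σ.2 i : ℕ) = 2 * i + 1) ∧
    (m ≤ (i : ℕ) → (σ.2 i : ℕ) + 2 * m = 2 * i)

/-- Type 2 of size `2m`, with word `(2m-1) (2m-3) … 1 (2m) (2m-2) … 2`. -/
def IsExceptionalType2 (m : ℕ) (σ : FinPerm) : Prop :=
  σ.size = 2 * m ∧ ∀ i : Fin σ.size,
    ((i : ℕ) < m → (σ.2 i : ℕ) + 2 * i + 2 = 2 * m) ∧
    (m ≤ (i : ℕ) → (σ.2 i : ℕ) + 2 * i + 1 = 4 * m)

/-- Type 3 of size `2m`, with word `(m+1) 1 (m+2) 2 … (2m) m`. -/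
def IsExceptionalType3 (m : ℕ) (σ : FinPerm) : Prop :=
  σ.size = 2 * m ∧ ∀ (i : Fin σ.size) (j : ℕ),
    ((i : ℕ) = 2 * j → (σ.2 i : ℕ) = m + j) ∧
    ((i : ℕ) = 2 * j + 1 → (σ.2 i : ℕ) = j)

/-- Type 4 of size `2m`, with word `m (2m) (m-1) (2m-1) … 1 (m+1)`. -/
def IsExceptionalType4 (m : ℕ) (σ : FinPerm) : Prop :=
  σ.size = 2 * m ∧ ∀ (i : Fin σ.size) (j : ℕ),
    ((i : ℕ) = 2 * j → (σ.2 i : ℕ) + j + 1 = m) ∧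
    ((i : ℕ) = 2 * j + 1 → (σ.2 i : ℕ) + j + 1 = 2 * m)

/-- `σ` is exceptional: for some `m ≥ 2` it is the permutation of size `2m` of one of the
four types. -/
def IsExceptional (σ : FinPerm) : Prop :=
  ∃ m : ℕ, 2 ≤ m ∧ (IsExceptionalType1 m σ ∨ IsExceptionalType2 m σ ∨
    IsExceptionalType3 m σ ∨ IsExceptionalType4 m σ)

end FinPerm

/-!
The chain is built from the bottom: below a simple `σ` that is not exceptional, every proper simple
pattern `π` of size at least 3 has a simple extension by one point inside `σ`
(`IsPattern.hasExtension`). Since only `σ` has to be non-exceptional, this iterates.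

Suppose `π` has no such extension. Intervals are treated as modules of a pair of linear orders:
sets that no outside element splits, in position or in value. A theorem of Ehrenfeucht and
Rozenberg (`SimpleOn.exists_extension`) says that an occurrence of `π` in `σ` extends to a simple
set `τ` with one or two more points, so here with two. Such a `τ` is critical: call a pair of its
points removable if deleting it leaves the pattern `π`. If `{v, w}` is removable, then `τ` without
`v` is not simple while `τ` without `v` and `w` is, so in `τ` without `v` the point `w` is either
extreme in both directions or has a twin `u`; in the second case `{v, u}` is removable too
(`IsRemovablePair.corner_or_step`). Following twins moves monotonically, so it ends at an extreme
point (`IsRemovablePair.exists_corner`). Up to a symmetry of the square this end is in the lower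
left corner, and following the twins from there determines the points of `τ` one by one
(`IsZigzag.step`): `τ` is `typeOne (m + 1)` and `π` is `typeOne m`
(`IsPattern.exists_dihedral_typeOne`).

It remains to treat `π = typeOne m` with `typeOne (m + 1)` contained in `σ`. A simple one-point
extension of `typeOne (k + 1)` contains a simple one-point extension of `typeOne k`
(`hasExtension_typeOne_of_succ`): delete two points whose values are consecutive, chosen so that the
additional point does not become extreme or a twin. This fails only for `k = 2` and two places of the
additional point, where the extension `2 5 3 1 4` of `2 4 1 3` is found directly.
Hence no `typeOne k` with `k ≥ m` has a simple one-point extension in `σ`, so by the first part all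
of them are contained in `σ`. This contradicts the finiteness of `σ`.
-/

namespace FinPerm

/-! ### Modules and patterns carried by sets of positions -/

/-- The position `c` does not distinguish `a` from `b`: it lies on the same side of both, in the
order of positions and in the order of values. -/
def Indist (σ : FinPerm) (c a b : Fin σ.size) : Prop :=
  (c < a ↔ c < b) ∧ (σ.2 c < σ.2 a ↔ σ.2 c < σ.2 b)

/-- `M` is a module of the permutation that `σ` induces on the set `S` of positions: no position
in `S` outside `M` distinguishes two elements of `M`. For `S = univ` the nonempty modules are the
intervals. -/
def IsModuleOf (σ : FinPerm) (S M : Set (Fin σ.size)) : Prop :=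
  M ⊆ S ∧ ∀ c ∈ S, c ∉ M → ∀ a ∈ M, ∀ b ∈ M, σ.Indist c a b

/-- The permutation that `σ` induces on the set `S` of positions is simple. -/
def SimpleOn (σ : FinPerm) (S : Set (Fin σ.size)) : Prop :=
  ∀ M, σ.IsModuleOf S M → M.Subsingleton ∨ M = S

/-- `f` lists the positions of an occurrence of `π` in `σ`. -/
def IsEmbedding (π σ : FinPerm) (f : Fin π.size → Fin σ.size) : Prop :=
  StrictMono f ∧ ∀ a b : Fin π.size, π.2 a < π.2 b ↔ σ.2 (f a) < σ.2 (f b)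

lemma Indist.symm {σ : FinPerm} {c a b : Fin σ.size} (h : σ.Indist c a b) : σ.Indist c b a :=
  ⟨h.1.symm, h.2.symm⟩

lemma Indist.trans {σ : FinPerm} {c a b d : Fin σ.size} (h : σ.Indist c a b)
    (h' : σ.Indist c b d) : σ.Indist c a d :=
  ⟨h.1.trans h'.1, h.2.trans h'.2⟩

/-- The relation of `a` to `u` and `v` seen from `u` and `v`. -/
lemma Indist.flip {σ : FinPerm} {a u v : Fin σ.size} (h : σ.Indist a u v) (hu : a ≠ u)
    (hv : a ≠ v) : (u < a ↔ v < a) ∧ (σ.2 u < σ.2 a ↔ σ.2 v < σ.2 a) := by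
  have hu' : σ.2 a ≠ σ.2 u := fun e => hu (σ.2.injective e)
  have hv' : σ.2 a ≠ σ.2 v := fun e => hv (σ.2.injective e)
  obtain ⟨h1, h2⟩ := h
  grind

lemma IsModuleOf.inter {σ : FinPerm} {S T M : Set (Fin σ.size)} (h : σ.IsModuleOf S M)
    (hT : T ⊆ S) : σ.IsModuleOf T (M ∩ T) :=
  ⟨Set.inter_subset_right, fun c hc hcM a ha b hb =>
    h.2 c (hT hc) (fun h' => hcM ⟨h', hc⟩) a ha.1 b hb.1⟩

lemma exists_eq_Icc_of_forall_lt_iff {n : ℕ} {M : Set (Fin n)} (hM : M.Nonempty)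
    (h : ∀ c ∉ M, ∀ a ∈ M, ∀ b ∈ M, (c < a ↔ c < b)) : ∃ a b, a ≤ b ∧ M = Set.Icc a b := by
  obtain ⟨a, ha⟩ := M.toFinite.exists_minimal hM
  obtain ⟨b, hb⟩ := M.toFinite.exists_maximal hM
  have ha' : ∀ x ∈ M, a ≤ x := fun x hx => (le_total a x).elim id (fun h => ha.2 hx h)
  have hb' : ∀ x ∈ M, x ≤ b := fun x hx => (le_total x b).elim id (fun h => hb.2 hx h)
  refine ⟨a, b, ha' b hb.1, Set.Subset.antisymm (fun x hx => ⟨ha' x hx, hb' x hx⟩) ?_⟩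
  intro x hx
  by_contra hxM
  have h1 : x ≠ b := fun e => hxM (e ▸ hb.1)
  have := (h x hxM a ha.1 b hb.1).2 (lt_of_le_of_ne hx.2 h1)
  exact absurd hx.1 (not_le.2 this)

lemma isSimple_iff_simpleOn_univ (σ : FinPerm) : σ.IsSimple ↔ σ.SimpleOn Set.univ := by
  constructor
  · intro h M hM
    rcases M.eq_empty_or_nonempty with rfl | hne
    · exact Or.inl Set.subsingleton_empty
    obtain ⟨a, b, hab, hI⟩ := exists_eq_Icc_of_forall_lt_iff hne
      (fun c hc a ha b hb => (hM.2 c trivial hc a ha b hb).1)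
    obtain ⟨c, d, -, hJ⟩ := exists_eq_Icc_of_forall_lt_iff (M := σ.2 '' M) (hne.image _) (by
      rintro c hc _ ⟨a, ha, rfl⟩ _ ⟨b, hb, rfl⟩
      obtain ⟨c, rfl⟩ := σ.2.surjective c
      exact (hM.2 c trivial (fun h' => hc ⟨c, h', rfl⟩) a ha b hb).2)
    rcases h a b hab ⟨c, d, by rw [← hI, hJ]⟩ with h | h
    · subst h
      left
      rw [hI, Set.Icc_self]
      exact Set.subsingleton_singleton
    · right; rw [hI, h]
  · rintro h a b hab ⟨c, d, hcd⟩
    have hM : σ.IsModuleOf Set.univ (Set.Icc a b) := by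
      refine ⟨Set.subset_univ _, fun x _ hx y hy z hz => ⟨?_, ?_⟩⟩
      · simp only [Set.mem_Icc] at hx hy hz
        grind
      · have hx' : σ.2 x ∉ Set.Icc c d := by
          rw [← hcd]; rintro ⟨w, hw, e⟩; exact hx (σ.2.injective e ▸ hw)
        have hy' : σ.2 y ∈ Set.Icc c d := hcd ▸ ⟨y, hy, rfl⟩
        have hz' : σ.2 z ∈ Set.Icc c d := hcd ▸ ⟨z, hz, rfl⟩
        simp only [Set.mem_Icc] at hx' hy' hz'
        grind
    rcases h _ hM with h | h
    · exact Or.inl (h ⟨le_rfl, hab⟩ ⟨hab, le_rfl⟩)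
    · exact Or.inr h

lemma IsEmbedding.indist_iff {π σ : FinPerm} {f : Fin π.size → Fin σ.size}
    (hf : IsEmbedding π σ f) (c a b : Fin π.size) :
    σ.Indist (f c) (f a) (f b) ↔ π.Indist c a b := by
  simp only [Indist, hf.1.lt_iff_lt, hf.2]

lemma IsEmbedding.simpleOn_image_iff {π σ : FinPerm} {f : Fin π.size → Fin σ.size}
    (hf : IsEmbedding π σ f) (S : Set (Fin π.size)) :
    σ.SimpleOn (f '' S) ↔ π.SimpleOn S := by
  have hinj := hf.1.injective
  constructor
  · intro h M hM
    have : σ.IsModuleOf (f '' S) (f '' M) := by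
      refine ⟨Set.image_mono hM.1, ?_⟩
      rintro _ ⟨c, hc, rfl⟩ hcM _ ⟨a, ha, rfl⟩ _ ⟨b, hb, rfl⟩
      exact (hf.indist_iff c a b).2 (hM.2 c hc (fun h' => hcM ⟨c, h', rfl⟩) a ha b hb)
    rcases h _ this with h | h
    · exact Or.inl (Set.subsingleton_of_image hinj _ h)
    · exact Or.inr (hinj.image_injective h)
  · intro h M hM
    have : π.IsModuleOf S (f ⁻¹' M ∩ S) := by
      refine ⟨Set.inter_subset_right, fun c hc hcM a ha b hb => (hf.indist_iff c a b).1 ?_⟩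
      exact hM.2 _ ⟨c, hc, rfl⟩ (fun h' => hcM ⟨h', hc⟩) _ ha.1 _ hb.1
    have hMe : M = f '' (f ⁻¹' M ∩ S) := by
      ext x
      constructor
      · intro hx
        obtain ⟨y, hy, rfl⟩ := hM.1 hx
        exact ⟨y, ⟨hx, hy⟩, rfl⟩
      · rintro ⟨y, hy, rfl⟩
        exact hy.1
    rcases h _ this with h | h
    · left; rw [hMe]; exact h.image f
    · right; rw [hMe, h]

lemma IsEmbedding.simpleOn_range_iff {π σ : FinPerm} {f : Fin π.size → Fin σ.size}
    (hf : IsEmbedding π σ f) : σ.SimpleOn (Set.range f) ↔ π.IsSimple := by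
  rw [← Set.image_univ, hf.simpleOn_image_iff, isSimple_iff_simpleOn_univ]

/-- Every set of positions carries a permutation. -/
lemma exists_isEmbedding_range_eq (σ : FinPerm) (S : Set (Fin σ.size)) :
    ∃ (τ : FinPerm) (f : Fin τ.size → Fin σ.size), IsEmbedding τ σ f ∧ Set.range f = S := by
  classical
  set F : Finset (Fin σ.size) := S.toFinset with hF
  set G : Finset (Fin σ.size) := F.map σ.2.toEmbedding with hG
  have hGc : G.card = F.card := Finset.card_map _
  let e₁ : Fin F.card ≃o F := F.orderIsoOfFin rfl
  let e₂ : Fin F.card ≃o G := G.orderIsoOfFin hGc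
  let e : F ≃ G := σ.2.subtypeEquiv (fun a => by simp [hG])
  refine ⟨⟨F.card, (e₁.toEquiv.trans e).trans e₂.symm.toEquiv⟩, fun i => (e₁ i : Fin σ.size),
    ⟨fun a b hab => e₁.strictMono hab, fun a b => ?_⟩, ?_⟩
  · change e₂.symm (e (e₁ a)) < e₂.symm (e (e₁ b)) ↔ _
    rw [e₂.symm.lt_iff_lt]
    rfl
  · ext x
    constructor
    · rintro ⟨i, rfl⟩
      exact Set.mem_toFinset.1 (e₁ i).2
    · intro hx
      exact ⟨e₁.symm ⟨x, by simpa [hF] using hx⟩, by simp⟩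

lemma IsEmbedding.isPattern_of_range_subset {π τ σ : FinPerm} {f : Fin π.size → Fin σ.size}
    {g : Fin τ.size → Fin σ.size} (hf : IsEmbedding π σ f) (hg : IsEmbedding τ σ g)
    (h : Set.range f ⊆ Set.range g) : ∃ k, IsEmbedding π τ k ∧ ∀ a, g (k a) = f a := by
  choose k hk using fun a => h ⟨a, rfl⟩
  refine ⟨k, ⟨fun a b hab => ?_, fun a b => ?_⟩, hk⟩
  · rw [← hg.1.lt_iff_lt, hk, hk]; exact hf.1 hab
  · rw [hg.2, hk, hk, hf.2]

lemma IsEmbedding.comp {π τ σ : FinPerm} {f : Fin π.size → Fin τ.size}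
    {g : Fin τ.size → Fin σ.size} (hg : IsEmbedding τ σ g) (hf : IsEmbedding π τ f) :
    IsEmbedding π σ (g ∘ f) :=
  ⟨hg.1.comp hf.1, fun a b => (hf.2 a b).trans (hg.2 _ _)⟩

lemma IsPattern.trans {π τ σ : FinPerm} (h : π.IsPattern τ) (h' : τ.IsPattern σ) :
    π.IsPattern σ := by
  obtain ⟨f, hf⟩ := h
  obtain ⟨g, hg⟩ := h'
  exact ⟨_, IsEmbedding.comp hg hf⟩

lemma IsPattern.size_le {π σ : FinPerm} (h : π.IsPattern σ) : π.size ≤ σ.size := by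
  obtain ⟨f, hf, -⟩ := h
  simpa using Fintype.card_le_of_injective f hf.injective

lemma eq_of_forall_val_eq {σ τ : FinPerm} (h : σ.size = τ.size)
    (h' : ∀ i : Fin σ.size, ∀ j : Fin τ.size, (i : ℕ) = j → (σ.2 i : ℕ) = τ.2 j) : σ = τ := by
  obtain ⟨n, s⟩ := σ
  obtain ⟨m, t⟩ := τ
  obtain rfl : n = m := h
  congr 1
  ext i
  exact h' i i rfl

lemma strictMono_eq_id {n : ℕ} {f : Fin n → Fin n} (hf : StrictMono f) : f = id := by
  have h : Set.range f = Set.range (id : Fin n → Fin n) := by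
    rw [Set.range_id, Set.range_eq_univ]
    exact Finite.surjective_of_injective hf.injective
  exact (StrictMono.range_inj hf strictMono_id).1 h

lemma IsPattern.eq_of_size_eq {π σ : FinPerm} (h : π.IsPattern σ) (hs : π.size = σ.size) :
    π = σ := by
  obtain ⟨n, s⟩ := σ
  obtain ⟨m, t⟩ := π
  obtain rfl : m = n := hs
  obtain ⟨f, hf, hv⟩ := h
  obtain rfl : f = id := strictMono_eq_id hf
  have hm : StrictMono (fun x => s (t.symm x)) := fun a b hab => by
    have := (hv (t.symm a) (t.symm b)).1 (by simpa using hab)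
    simpa using this
  have := strictMono_eq_id hm
  congr 1
  ext i
  have h2 := congrFun this (t i)
  simp only [Equiv.symm_apply_apply, id] at h2
  rw [h2]

lemma IsEmbedding.eq_of_range_eq {π τ σ : FinPerm} {f : Fin π.size → Fin σ.size}
    {g : Fin τ.size → Fin σ.size} (hf : IsEmbedding π σ f) (hg : IsEmbedding τ σ g)
    (h : Set.range f = Set.range g) : π = τ := by
  obtain ⟨k, hk, -⟩ := hf.isPattern_of_range_subset hg h.le
  obtain ⟨k', hk', -⟩ := hg.isPattern_of_range_subset hf h.ge
  have h1 : π.IsPattern τ := ⟨k, hk⟩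
  have h2 : τ.IsPattern π := ⟨k', hk'⟩
  exact h1.eq_of_size_eq (le_antisymm h1.size_le h2.size_le)

lemma IsEmbedding.ncard_range {π σ : FinPerm} {f : Fin π.size → Fin σ.size}
    (hf : IsEmbedding π σ f) : (Set.range f).ncard = π.size := by
  rw [← Set.image_univ, Set.ncard_image_of_injective _ hf.1.injective, Set.ncard_univ]
  simp

/-! ### Extending a simple set of positions by one or two points -/

/-- If `X` is simple and `X ∪ {v}` is not, then `v` lies on one side of `X` in both orders or it
is a twin of some element of `X`. -/
lemma SimpleOn.corner_or_twin {σ : FinPerm} {X : Set (Fin σ.size)} (hX : σ.SimpleOn X)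
    {v : Fin σ.size} (hv : v ∉ X) (hn : ¬ σ.SimpleOn (insert v X)) :
    σ.IsModuleOf (insert v X) X ∨ ∃ u ∈ X, σ.IsModuleOf (insert v X) {u, v} := by
  simp only [SimpleOn, not_forall] at hn
  obtain ⟨M, hM, hM'⟩ := hn
  push Not at hM'
  obtain ⟨hM1, hM2⟩ := hM'
  rcases hX _ (hM.inter (Set.subset_insert v X)) with h | h
  · right
    have hvM : v ∈ M := by
      by_contra hvM
      have : M ∩ X = M := Set.inter_eq_left.2 fun x hx =>
        (hM.1 hx).resolve_left (fun e => hvM (e ▸ hx))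
      rw [this] at h
      exact (Set.not_subsingleton_iff.2 hM1) h
    obtain ⟨u, hu, huv⟩ := hM1.exists_ne v
    have huX : u ∈ X := (hM.1 hu).resolve_left huv
    refine ⟨u, huX, ?_⟩
    have : M = {u, v} := by
      ext x
      simp only [Set.mem_insert_iff, Set.mem_singleton_iff]
      constructor
      · intro hx
        rcases hM.1 hx with rfl | hxX
        · exact Or.inr rfl
        · exact Or.inl (h ⟨hx, hxX⟩ ⟨hu, huX⟩)
      · rintro (rfl | rfl) <;> assumption
    exact this ▸ hM
  · left
    have hXM : X ⊆ M := Set.inter_eq_right.1 h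
    have hvM : v ∉ M := fun hvM => hM2 (Set.Subset.antisymm hM.1 (Set.insert_subset hvM hXM))
    have : M = X := Set.Subset.antisymm
      (fun x hx => (hM.1 hx).resolve_left (fun e => hvM (e ▸ hx))) hXM
    exact this ▸ hM

/-- `v` is a twin of `u` over `X`: no other element of `X` distinguishes them. -/
def IsTwin (σ : FinPerm) (X : Set (Fin σ.size)) (u v : Fin σ.size) : Prop :=
  ∀ c ∈ X, c ≠ u → σ.Indist c u v

lemma SimpleOn.twin_unique {σ : FinPerm} {X : Set (Fin σ.size)} (hX : σ.SimpleOn X)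
    (h3 : ∀ a b, ∃ c ∈ X, c ≠ a ∧ c ≠ b) {u x v : Fin σ.size} (hu : u ∈ X) (hx : x ∈ X)
    (h : σ.IsTwin X u v) (h' : σ.IsTwin X x v) : u = x := by
  have hM : σ.IsModuleOf X {u, x} := by
    refine ⟨by rintro _ (rfl | rfl) <;> assumption, fun c hc hcM a ha b hb => ?_⟩
    simp only [Set.mem_insert_iff, Set.mem_singleton_iff, not_or] at hcM
    have key : ∀ a ∈ ({u, x} : Set (Fin σ.size)), σ.Indist c a v := by
      rintro _ (rfl | rfl)
      · exact h c hc hcM.1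
      · exact h' c hc hcM.2
    exact (key a ha).trans (key b hb).symm
  rcases hX _ hM with h | h
  · exact h (by simp) (by simp)
  · obtain ⟨c, hc, h1, h2⟩ := h3 u x
    rw [← h] at hc
    rcases hc with e | e
    · exact absurd e h1
    · exact absurd e h2

lemma SimpleOn.not_corner_of_twin {σ : FinPerm} {X : Set (Fin σ.size)} (hX : σ.SimpleOn X)
    (h3 : ∀ a b, ∃ c ∈ X, c ≠ a ∧ c ≠ b) {u v : Fin σ.size} (hu : u ∈ X) (hv : v ∉ X)
    (h : σ.IsTwin X u v) (hc : ∀ a ∈ X, ∀ b ∈ X, σ.Indist v a b) : False := by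
  have hM : σ.IsModuleOf X (X \ {u}) := by
    refine ⟨Set.sdiff_subset, fun c hcX hcM a ha b hb => ?_⟩
    have : c = u := by
      by_contra hcu
      exact hcM ⟨hcX, hcu⟩
    subst this
    have hab := hc a ha.1 b hb.1
    have h1 := (h a ha.1 ha.2).flip ha.2 (fun e => hv (e ▸ ha.1))
    have h2 := (h b hb.1 hb.2).flip hb.2 (fun e => hv (e ▸ hb.1))
    exact ⟨h1.1.trans (hab.1.trans h2.1.symm), h1.2.trans (hab.2.trans h2.2.symm)⟩
  rcases hX _ hM with h | h
  · obtain ⟨c, hcX, hcu, -⟩ := h3 u u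
    obtain ⟨d, hdX, hdu, hdc⟩ := h3 u c
    exact hdc (h ⟨hdX, hdu⟩ ⟨hcX, hcu⟩)
  · have : u ∈ X \ {u} := by rw [h]; exact hu
    exact this.2 rfl

/-- Two points outside a simple set `X`, the first a twin of `u ∈ X` and the second not: if
adding both does not give a simple set, then the second does not distinguish the first
from `u`. -/
lemma SimpleOn.indist_of_not_simpleOn {σ : FinPerm} {X : Set (Fin σ.size)} (hX : σ.SimpleOn X)
    (h3 : ∀ a b, ∃ c ∈ X, c ≠ a ∧ c ≠ b) {u v w : Fin σ.size} (hu : u ∈ X) (hv : v ∉ X)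
    (hw : w ∉ X) (hvw : v ≠ w) (h : σ.IsTwin X u v) (hwu : ¬ σ.IsTwin X u w)
    (hn : ¬ σ.SimpleOn (insert v (insert w X))) : σ.Indist w u v := by
  simp only [SimpleOn, not_forall] at hn
  obtain ⟨M, hM, hM'⟩ := hn
  push Not at hM'
  obtain ⟨hM1, hM2⟩ := hM'
  have hXS : X ⊆ insert v (insert w X) := fun x hx => Or.inr (Or.inr hx)
  have huv : u ≠ v := fun e => hv (e ▸ hu)
  have huw : u ≠ w := fun e => hw (e ▸ hu)
  rcases hX _ (hM.inter hXS) with hs | hs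
  · rcases (M ∩ X).eq_empty_or_nonempty with he | ⟨x, hxM, hxX⟩
    · -- `M = {v, w}`, so `w` is a twin of `v` and hence of `u`
      exfalso
      have hMX : ∀ y ∈ M, y = v ∨ y = w := fun y hy => by
        rcases hM.1 hy with e | e | e
        · exact Or.inl e
        · exact Or.inr e
        · exact absurd (show y ∈ M ∩ X from ⟨hy, e⟩) (by rw [he]; exact id)
      have hvM : v ∈ M := by
        obtain ⟨y, hy, hyw⟩ := hM1.exists_ne w
        rcases hMX y hy with rfl | rfl
        · exact hy
        · exact absurd rfl hyw
      have hwM : w ∈ M := by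
        obtain ⟨y, hy, hyv⟩ := hM1.exists_ne v
        rcases hMX y hy with rfl | rfl
        · exact absurd rfl hyv
        · exact hy
      refine hwu fun c hc hcu => (h c hc hcu).trans (hM.2 c (hXS hc) ?_ v hvM w hwM)
      intro hcM
      rcases hMX c hcM with rfl | rfl
      · exact hv hc
      · exact hw hc
    · have hcX : ∀ c ∈ X, c ≠ x → c ∉ M := fun c hc hcx hcM => hcx (hs ⟨hcM, hc⟩ ⟨hxM, hxX⟩)
      by_cases hvM : v ∈ M
      · have : u = x := hX.twin_unique h3 hu hxX h
          (fun c hc hcx => hM.2 c (hXS hc) (hcX c hc hcx) x hxM v hvM)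
        subst this
        by_cases hwM : w ∈ M
        · exact absurd (fun c hc hcx => hM.2 c (hXS hc) (hcX c hc hcx) u hxM w hwM) hwu
        · exact hM.2 w (by simp) hwM u hxM v hvM
      · have hwM : w ∈ M := by
          obtain ⟨y, hy, hyx⟩ := hM1.exists_ne x
          rcases hM.1 hy with rfl | rfl | e
          · exact absurd hy hvM
          · exact hy
          · exact absurd hy (hcX y e hyx)
        have hxu : x ≠ u := by
          rintro rfl
          exact hwu (fun c hc hcx => hM.2 c (hXS hc) (hcX c hc hcx) x hxM w hwM)
        -- `{x, w}` is a module, so `w` sees `u` and `v` as `x` does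
        have h1 := (hM.2 u (hXS hu) (hcX u hu hxu.symm) x hxM w hwM).flip hxu.symm huw
        have h2 := (hM.2 v (by simp) hvM x hxM w hwM).flip
          (fun e => hv (e ▸ hxX)) hvw
        have h0 := h x hxX hxu
        exact ⟨h1.1.symm.trans (h0.1.trans h2.1), h1.2.symm.trans (h0.2.trans h2.2)⟩
  · have hXM : X ⊆ M := Set.inter_eq_right.1 hs
    by_cases hvM : v ∈ M
    · have hwM : w ∉ M := fun hwM => hM2 (Set.Subset.antisymm hM.1
        (Set.insert_subset hvM (Set.insert_subset hwM hXM)))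
      exact hM.2 w (by simp) hwM u (hXM hu) v hvM
    · exact (hX.not_corner_of_twin h3 hu hv h
        (fun a ha b hb => hM.2 v (by simp) hvM a (hXM ha) b (hXM hb))).elim

/-- A proper simple subset of a simple permutation extends to a simple subset with one or two more
elements. -/
theorem SimpleOn.exists_extension {σ : FinPerm} {X : Set (Fin σ.size)}
    (hσ : σ.SimpleOn Set.univ) (hX : σ.SimpleOn X)
    (h3 : ∀ a b, ∃ c ∈ X, c ≠ a ∧ c ≠ b) (hne : X ≠ Set.univ) :
    (∃ v ∉ X, σ.SimpleOn (insert v X)) ∨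
      ∃ v ∉ X, ∃ w ∉ X, v ≠ w ∧ σ.SimpleOn (insert v (insert w X)) := by
  by_contra hcon
  push Not at hcon
  obtain ⟨h1, h2⟩ := hcon
  obtain ⟨v₀, -⟩ := (Set.ne_univ_iff_exists_notMem X).1 hne
  obtain ⟨p, hpX, -, -⟩ := h3 v₀ v₀
  by_cases htw : ∃ u ∈ X, ∃ v ∉ X, σ.IsTwin X u v
  · obtain ⟨u, hu, v, hv, huv⟩ := htw
    have hM : σ.IsModuleOf Set.univ (insert u {x | x ∉ X ∧ σ.IsTwin X u x}) := by
      refine ⟨Set.subset_univ _, fun c _ hcM => ?_⟩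
      simp only [Set.mem_insert_iff, Set.mem_ofPred_eq, not_or, not_and] at hcM
      have key : ∀ a ∈ insert u {x | x ∉ X ∧ σ.IsTwin X u x}, σ.Indist c u a := by
        rintro a (rfl | ⟨haX, ha⟩)
        · exact ⟨Iff.rfl, Iff.rfl⟩
        · by_cases hcX : c ∈ X
          · exact ha c hcX hcM.1
          · have hac : a ≠ c := fun e => hcM.2 hcX (e ▸ ha)
            exact hX.indist_of_not_simpleOn h3 hu haX hcX hac ha (hcM.2 hcX)
              (h2 a haX c hcX hac)
      exact fun a ha b hb => (key a ha).symm.trans (key b hb)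
    rcases hσ _ hM with h | h
    · exact hv (h (Set.mem_insert u _) (Set.mem_insert_of_mem _ ⟨hv, huv⟩) ▸ hu)
    · obtain ⟨c, hc, hcu, -⟩ := h3 u u
      have : c ∈ insert u {x | x ∉ X ∧ σ.IsTwin X u x} := by rw [h]; trivial
      rcases this with e | e
      · exact hcu e
      · exact e.1 hc
  · push Not at htw
    have hM : σ.IsModuleOf Set.univ X := by
      refine ⟨Set.subset_univ _, fun c _ hcX => ?_⟩
      rcases hX.corner_or_twin hcX (h1 c hcX) with h | ⟨u, hu, h⟩
      · exact h.2 c (by simp) hcX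
      · refine absurd ?_ (htw u hu c hcX)
        intro d hd hdu
        refine h.2 d (Set.mem_insert_of_mem _ hd) ?_ u (by simp) c (by simp)
        rintro (e | e)
        · exact hdu e
        · exact hcX (e ▸ hd)
    rcases hσ _ hM with h | h
    · obtain ⟨c, hc, hcu, -⟩ := h3 p p
      exact hcu (h hc hpX)
    · exact hne h

/-! ### Symmetries -/

/-- The reverse of a permutation. -/
abbrev rev (σ : FinPerm) : FinPerm := ⟨σ.1, Fin.revPerm.trans σ.2⟩

/-- The inverse of a permutation. -/
abbrev inv (σ : FinPerm) : FinPerm := ⟨σ.1, σ.2.symm⟩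

lemma rev_rev (σ : FinPerm) : σ.rev.rev = σ :=
  eq_of_forall_val_eq rfl fun i j h => by
    obtain rfl : i = j := Fin.ext h
    exact congrArg (fun x => (σ.2 x : ℕ)) (Fin.rev_rev i)

lemma inv_inv (σ : FinPerm) : σ.inv.inv = σ := rfl

lemma IsEmbedding.rev {π σ : FinPerm} {f : Fin π.size → Fin σ.size} (hf : IsEmbedding π σ f) :
    IsEmbedding π.rev σ.rev (fun i => (f i.rev).rev) := by
  refine ⟨fun a b hab => ?_, fun a b => ?_⟩
  · exact Fin.rev_lt_rev.2 (hf.1 (Fin.rev_lt_rev.2 hab))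
  · have e : ∀ x : Fin σ.size, σ.rev.2 x.rev = σ.2 x := fun x =>
      congrArg σ.2 (Fin.rev_rev x)
    rw [e, e]
    exact hf.2 a.rev b.rev

lemma IsEmbedding.inv {π σ : FinPerm} {f : Fin π.size → Fin σ.size} (hf : IsEmbedding π σ f) :
    IsEmbedding π.inv σ.inv (fun i => σ.2 (f (π.2.symm i))) := by
  refine ⟨fun a b hab => ?_, fun a b => ?_⟩
  · refine (hf.2 _ _).1 ?_
    simpa using hab
  · simp only [Equiv.symm_apply_apply]
    exact hf.1.lt_iff_lt.symm

lemma IsPattern.rev {π σ : FinPerm} (h : π.IsPattern σ) : π.rev.IsPattern σ.rev :=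
  let ⟨_, hf⟩ := h
  ⟨_, IsEmbedding.rev hf⟩

lemma IsPattern.inv {π σ : FinPerm} (h : π.IsPattern σ) : π.inv.IsPattern σ.inv :=
  let ⟨_, hf⟩ := h
  ⟨_, IsEmbedding.inv hf⟩

lemma IsSimple.rev {σ : FinPerm} (h : σ.IsSimple) : σ.rev.IsSimple := by
  rw [isSimple_iff_simpleOn_univ] at h ⊢
  intro M hM
  have : σ.IsModuleOf Set.univ (Fin.rev ⁻¹' M) := by
    refine ⟨Set.subset_univ _, fun c _ hc a ha b hb => ?_⟩
    obtain ⟨h1, h2⟩ := hM.2 c.rev trivial hc a.rev ha b.rev hb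
    have e : ∀ x : Fin σ.size, σ.rev.2 x.rev = σ.2 x := fun x =>
      congrArg σ.2 (Fin.rev_rev x)
    rw [e, e, e] at h2
    refine ⟨?_, h2⟩
    have hca : c ≠ a := fun e => hc (e ▸ ha)
    have hcb : c ≠ b := fun e => hc (e ▸ hb)
    rw [Fin.rev_lt_rev, Fin.rev_lt_rev] at h1
    grind
  rcases h _ this with h | h
  · left
    intro x hx y hy
    have := h (x := x.rev) (show x.rev.rev ∈ M by rwa [Fin.rev_rev])
      (y := y.rev) (show y.rev.rev ∈ M by rwa [Fin.rev_rev])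
    exact Fin.rev_injective this
  · right
    refine Set.eq_univ_of_forall fun x => ?_
    have : x.rev ∈ Fin.rev ⁻¹' M := h ▸ Set.mem_univ _
    simpa using this

lemma IsSimple.inv {σ : FinPerm} (h : σ.IsSimple) : σ.inv.IsSimple := by
  rw [isSimple_iff_simpleOn_univ] at h ⊢
  intro M hM
  have : σ.IsModuleOf Set.univ (σ.2 ⁻¹' M) := by
    refine ⟨Set.subset_univ _, fun c _ hc a ha b hb => ?_⟩
    obtain ⟨h1, h2⟩ := hM.2 (σ.2 c) trivial hc (σ.2 a) ha (σ.2 b) hb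
    simp only [Equiv.symm_apply_apply] at h2
    exact ⟨h2, h1⟩
  rcases h _ this with h | h
  · left
    intro x hx y hy
    have := h (x := σ.2.symm x) (show σ.2 (σ.2.symm x) ∈ M by rwa [Equiv.apply_symm_apply])
      (y := σ.2.symm y) (show σ.2 (σ.2.symm y) ∈ M by rwa [Equiv.apply_symm_apply])
    exact σ.2.symm.injective this
  · right
    refine Set.eq_univ_of_forall fun x => ?_
    have : σ.2.symm x ∈ σ.2 ⁻¹' M := h ▸ Set.mem_univ _
    simpa using this

/-- The symmetries of the square, acting on permutations through their diagrams. -/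
inductive IsDihedral : (FinPerm → FinPerm) → Prop
  | id : IsDihedral id
  | rev {g : FinPerm → FinPerm} (h : IsDihedral g) : IsDihedral (fun σ => (g σ).rev)
  | inv {g : FinPerm → FinPerm} (h : IsDihedral g) : IsDihedral (fun σ => (g σ).inv)

namespace IsDihedral

variable {g : FinPerm → FinPerm}

lemma comp {g' : FinPerm → FinPerm} (h : IsDihedral g) (h' : IsDihedral g') :
    IsDihedral (fun σ => g (g' σ)) := by
  induction h with
  | id => exact h'
  | rev _ ih => exact ih.rev
  | inv _ ih => exact ih.inv

lemma size_eq (h : IsDihedral g) (σ : FinPerm) : (g σ).size = σ.size := by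
  induction h with
  | id => rfl
  | rev _ ih => exact ih
  | inv _ ih => exact ih

lemma isPattern (h : IsDihedral g) {π σ : FinPerm} (hp : π.IsPattern σ) :
    (g π).IsPattern (g σ) := by
  induction h with
  | id => exact hp
  | rev _ ih => exact ih.rev
  | inv _ ih => exact ih.inv

lemma isSimple (h : IsDihedral g) {σ : FinPerm} (hs : σ.IsSimple) : (g σ).IsSimple := by
  induction h with
  | id => exact hs
  | rev _ ih => exact ih.rev
  | inv _ ih => exact ih.inv

lemma exists_inverse (h : IsDihedral g) :
    ∃ g', IsDihedral g' ∧ (∀ σ, g' (g σ) = σ) ∧ ∀ σ, g (g' σ) = σ := by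
  induction h with
  | id => exact ⟨_, .id, fun _ => rfl, fun _ => rfl⟩
  | rev _ ih =>
    obtain ⟨g', h', h1, h2⟩ := ih
    exact ⟨_, h'.comp (IsDihedral.id.rev), fun σ => by simp [rev_rev, h1],
      fun σ => by simp [rev_rev, h2]⟩
  | inv _ ih =>
    obtain ⟨g', h', h1, h2⟩ := ih
    exact ⟨_, h'.comp (IsDihedral.id.inv), fun σ => by simp [inv_inv, h1],
      fun σ => by simp [inv_inv, h2]⟩

end IsDihedral

/-! ### The exceptional permutations -/

/-- The exceptional permutation `2 4 … (2m) 1 3 … (2m-1)` of type 1. -/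
def typeOne (m : ℕ) : FinPerm :=
  ⟨2 * m,
    { toFun := fun i => if h : (i : ℕ) < m then ⟨2 * i + 1, by omega⟩ else ⟨2 * i - 2 * m, by omega⟩
      invFun := fun v => if h : (v : ℕ) % 2 = 1 then ⟨v / 2, by omega⟩ else ⟨m + v / 2, by omega⟩
      left_inv := fun i => by
        by_cases h : (i : ℕ) < m
        · have : (2 * (i : ℕ) + 1) % 2 = 1 := by omega
          ext; simp only [h, dite_true, this]; omega
        · have : ¬ (2 * (i : ℕ) - 2 * m) % 2 = 1 := by omega
          ext; simp only [h, dite_false, this]; omega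
      right_inv := fun v => by
        by_cases h : (v : ℕ) % 2 = 1
        · have : (v : ℕ) / 2 < m := by omega
          ext; simp only [h, dite_true, this]; omega
        · have : ¬ m + (v : ℕ) / 2 < m := by omega
          ext; simp only [h, dite_false, this]; omega }⟩

lemma typeOne_apply (m : ℕ) (i : Fin (typeOne m).size) :
    ((typeOne m).2 i : ℕ) = if (i : ℕ) < m then 2 * (i : ℕ) + 1 else 2 * i - 2 * m := by
  change ((dite _ _ _ : Fin (2 * m)) : ℕ) = _
  split_ifs <;> rfl

lemma typeOne_symm_apply (m : ℕ) (v : Fin (typeOne m).size) :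
    ((typeOne m).2.symm v : ℕ) = if (v : ℕ) % 2 = 1 then (v : ℕ) / 2 else m + v / 2 := by
  change ((dite _ _ _ : Fin (2 * m)) : ℕ) = _
  split_ifs <;> rfl

lemma typeOne_size (m : ℕ) : (typeOne m).size = 2 * m := rfl

lemma isExceptionalType1_typeOne (m : ℕ) : IsExceptionalType1 m (typeOne m) := by
  refine ⟨rfl, fun i => ?_⟩
  rw [typeOne_apply]
  constructor <;> intro h <;> split_ifs <;> omega

lemma isExceptionalType2_rev_typeOne (m : ℕ) : IsExceptionalType2 m (typeOne m).rev := by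
  refine ⟨rfl, fun i => ?_⟩
  have hi : (i : ℕ) < 2 * m := i.2
  have hr : ((Fin.rev i : Fin (typeOne m).size) : ℕ) = 2 * m - (i + 1) := Fin.val_rev i
  have e : (typeOne m).rev.2 i = (typeOne m).2 i.rev := rfl
  rw [e, typeOne_apply, hr]
  constructor <;> intro h <;> split_ifs <;> omega

lemma isExceptionalType3_inv_typeOne (m : ℕ) : IsExceptionalType3 m (typeOne m).inv := by
  refine ⟨rfl, fun i j => ?_⟩
  have e : (typeOne m).inv.2 i = (typeOne m).2.symm i := rfl
  rw [e, typeOne_symm_apply]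
  constructor <;> intro h <;> split_ifs <;> omega

lemma isExceptionalType4_rev_inv_typeOne (m : ℕ) :
    IsExceptionalType4 m (typeOne m).inv.rev := by
  refine ⟨rfl, fun i j => ?_⟩
  have hi : (i : ℕ) < 2 * m := i.2
  have hr : ((Fin.rev i : Fin (typeOne m).size) : ℕ) = 2 * m - (i + 1) := Fin.val_rev i
  have e : (typeOne m).inv.rev.2 i = (typeOne m).2.symm i.rev := rfl
  rw [e, typeOne_symm_apply, hr]
  constructor <;> intro h <;> split_ifs <;> omega

/-- The type-1 permutations are invariant under the half-turn of the diagram, so the eight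
symmetries give only four types. -/
lemma inv_rev_typeOne (m : ℕ) : (typeOne m).rev.inv = (typeOne m).inv.rev := by
  refine eq_of_forall_val_eq rfl fun i j h => ?_
  obtain rfl : i = j := Fin.ext h
  have hi : (i : ℕ) < 2 * m := i.2
  have hr : ((Fin.rev i : Fin (typeOne m).size) : ℕ) = 2 * m - (i + 1) := Fin.val_rev i
  have h1 : (typeOne m).rev.inv.2 i = Fin.rev ((typeOne m).2.symm i) := rfl
  have h2 : (typeOne m).inv.rev.2 i = (typeOne m).2.symm i.rev := rfl
  rw [h1, h2, Fin.val_rev, typeOne_symm_apply, typeOne_symm_apply, hr]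
  change 2 * m - _ = _
  split_ifs <;> omega

lemma IsDihedral.apply_typeOne {g : FinPerm → FinPerm} (h : IsDihedral g) :
    (∀ m, g (typeOne m) = typeOne m) ∨ (∀ m, g (typeOne m) = (typeOne m).rev) ∨
      (∀ m, g (typeOne m) = (typeOne m).inv) ∨ ∀ m, g (typeOne m) = (typeOne m).inv.rev := by
  induction h with
  | id => exact Or.inl fun _ => rfl
  | rev _ ih =>
    rcases ih with ih | ih | ih | ih
    · exact Or.inr (Or.inl fun m => by simp only [ih])
    · exact Or.inl fun m => by simp only [ih, rev_rev]
    · exact Or.inr (Or.inr (Or.inr fun m => by simp only [ih]))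
    · exact Or.inr (Or.inr (Or.inl fun m => by simp only [ih, rev_rev]))
  | inv _ ih =>
    rcases ih with ih | ih | ih | ih
    · exact Or.inr (Or.inr (Or.inl fun m => by simp only [ih]))
    · exact Or.inr (Or.inr (Or.inr fun m => by simp only [ih, inv_rev_typeOne]))
    · exact Or.inl fun m => by simp only [ih, inv_inv]
    · exact Or.inr (Or.inl fun m => by simp only [ih, ← inv_rev_typeOne, inv_inv])

lemma IsDihedral.isExceptional {g : FinPerm → FinPerm} (h : IsDihedral g) {m : ℕ} (hm : 2 ≤ m) :
    (g (typeOne m)).IsExceptional := by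
  refine ⟨m, hm, ?_⟩
  rcases h.apply_typeOne with h | h | h | h <;> rw [h]
  · exact Or.inl (isExceptionalType1_typeOne m)
  · exact Or.inr (Or.inl (isExceptionalType2_rev_typeOne m))
  · exact Or.inr (Or.inr (Or.inl (isExceptionalType3_inv_typeOne m)))
  · exact Or.inr (Or.inr (Or.inr (isExceptionalType4_rev_inv_typeOne m)))

/-- From size 6 on the four types are distinct, so a symmetry that fixes one permutation of type 1
fixes them all. For size 4 this fails: types 1 and 4 coincide there. -/
lemma IsDihedral.apply_typeOne_eq {g : FinPerm → FinPerm} (h : IsDihedral g) {m : ℕ} (hm : 3 ≤ m)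
    (hg : g (typeOne m) = typeOne m) (k : ℕ) : g (typeOne k) = typeOne k := by
  have h1 := isExceptionalType1_typeOne m
  have h01 := (h1.2 ⟨0, by rw [typeOne_size]; omega⟩).1 (by simp; omega)
  have h11 := (h1.2 ⟨1, by rw [typeOne_size]; omega⟩).1 (by simp; omega)
  rcases h.apply_typeOne with h | h | h | h
  · exact h k
  · exfalso
    have h2 := isExceptionalType2_rev_typeOne m
    rw [← h m, hg] at h2
    have h02 := (h2.2 ⟨0, by rw [typeOne_size]; omega⟩).1 (by simp; omega)
    simp only at h01 h02
    omega
  · exfalso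
    have h2 := isExceptionalType3_inv_typeOne m
    rw [← h m, hg] at h2
    have h02 := (h2.2 ⟨0, by rw [typeOne_size]; omega⟩ 0).1 (by simp)
    simp only at h01 h02
    omega
  · exfalso
    have h2 := isExceptionalType4_rev_inv_typeOne m
    rw [← h m, hg] at h2
    have h02 := (h2.2 ⟨0, by rw [typeOne_size]; omega⟩ 0).1 (by simp)
    have h12 := (h2.2 ⟨1, by rw [typeOne_size]; omega⟩ 0).2 (by simp)
    simp only at h01 h02 h11 h12
    omega

/-! ### One-point extensions and removable pairs -/

/-- `π` has a simple one-point extension inside `σ`. -/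
def HasExtension (π σ : FinPerm) : Prop :=
  ∃ τ : FinPerm, τ.IsSimple ∧ π.IsPattern τ ∧ τ.IsPattern σ ∧ τ.size = π.size + 1

lemma IsEmbedding.hasExtension {π σ : FinPerm} {f : Fin π.size → Fin σ.size}
    (hf : IsEmbedding π σ f) {v : Fin σ.size} (hv : v ∉ Set.range f)
    (hs : σ.SimpleOn (insert v (Set.range f))) : HasExtension π σ := by
  obtain ⟨τ, g, hg, hgr⟩ := exists_isEmbedding_range_eq σ (insert v (Set.range f))
  obtain ⟨k, hk, -⟩ := hf.isPattern_of_range_subset hg (by rw [hgr]; exact Set.subset_insert _ _)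
  refine ⟨τ, hg.simpleOn_range_iff.1 (hgr ▸ hs), ⟨k, hk⟩, ⟨g, hg⟩, ?_⟩
  rw [← hg.ncard_range, hgr, Set.ncard_insert_of_notMem hv, hf.ncard_range]

lemma IsDihedral.hasExtension {g : FinPerm → FinPerm} (h : IsDihedral g) {π σ : FinPerm}
    (he : HasExtension π σ) : HasExtension (g π) (g σ) := by
  obtain ⟨τ, h1, h2, h3, h4⟩ := he
  exact ⟨g τ, h.isSimple h1, h.isPattern h2, h.isPattern h3, by rw [h.size_eq, h.size_eq, h4]⟩

lemma IsSimple.not_indist_pair {σ : FinPerm} (hσ : σ.IsSimple) (hn : 3 ≤ σ.size)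
    {a b : Fin σ.size} (hab : a ≠ b) : ¬ ∀ c, c ≠ a → c ≠ b → σ.Indist c a b := by
  intro h
  rw [isSimple_iff_simpleOn_univ] at hσ
  have hM : σ.IsModuleOf Set.univ {a, b} := by
    refine ⟨Set.subset_univ _, fun c _ hc => ?_⟩
    simp only [Set.mem_insert_iff, Set.mem_singleton_iff, not_or] at hc
    have := h c hc.1 hc.2
    rintro x (rfl | rfl) y (rfl | rfl)
    exacts [⟨Iff.rfl, Iff.rfl⟩, this, this.symm, ⟨Iff.rfl, Iff.rfl⟩]
  rcases hσ _ hM with h | h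
  · exact hab (h (by simp) (by simp))
  · have h1 := Set.ncard_univ (Fin σ.size)
    rw [← h, Set.ncard_pair hab, Nat.card_fin] at h1
    omega

lemma IsSimple.not_indist_triple {σ : FinPerm} (hσ : σ.IsSimple) (hn : 4 ≤ σ.size)
    {a b d : Fin σ.size} (hab : a ≠ b) :
    ¬ ∀ c, c ≠ a → c ≠ b → c ≠ d → σ.Indist c a b ∧ σ.Indist c b d := by
  intro h
  rw [isSimple_iff_simpleOn_univ] at hσ
  have hM : σ.IsModuleOf Set.univ {a, b, d} := by
    refine ⟨Set.subset_univ _, fun c _ hc => ?_⟩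
    simp only [Set.mem_insert_iff, Set.mem_singleton_iff, not_or] at hc
    obtain ⟨h1, h2⟩ := h c hc.1 hc.2.1 hc.2.2
    rintro x (rfl | rfl | rfl) y (rfl | rfl | rfl)
    exacts [⟨Iff.rfl, Iff.rfl⟩, h1, h1.trans h2, h1.symm, ⟨Iff.rfl, Iff.rfl⟩, h2,
      (h1.trans h2).symm, h2.symm, ⟨Iff.rfl, Iff.rfl⟩]
  rcases hσ _ hM with h | h
  · exact hab (h (by simp) (by simp))
  · have h1 := Set.ncard_univ (Fin σ.size)
    have h2 := Set.ncard_insert_le a {b, d}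
    have h3 := Set.ncard_insert_le b {d}
    rw [Set.ncard_singleton] at h3
    rw [← h, Nat.card_fin] at h1
    omega

lemma IsSimple.not_corner {σ : FinPerm} (hσ : σ.IsSimple) (hn : 3 ≤ σ.size)
    (z : Fin σ.size) : ¬ ∀ a b, a ≠ z → b ≠ z → σ.Indist z a b := by
  intro h
  rw [isSimple_iff_simpleOn_univ] at hσ
  have hM : σ.IsModuleOf Set.univ {z}ᶜ := by
    refine ⟨Set.subset_univ _, fun c _ hc a ha b hb => ?_⟩
    obtain rfl : c = z := by simpa using hc
    exact h a b ha hb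
  have h1 := Set.ncard_compl {z}
  rw [Set.ncard_singleton, Nat.card_fin] at h1
  rcases hσ _ hM with h | h
  · have := Set.ncard_le_one_iff_subsingleton.2 h
    omega
  · rw [h, Set.ncard_univ, Nat.card_fin] at h1
    omega

/-- Deleting the positions `v` and `w` from `σ` leaves the pattern `π`. -/
def IsRemovablePair (π σ : FinPerm) (v w : Fin σ.size) : Prop :=
  v ≠ w ∧ ∃ f, IsEmbedding π σ f ∧ Set.range f = {v, w}ᶜ

lemma IsRemovablePair.symm {π σ : FinPerm} {v w : Fin σ.size} (h : IsRemovablePair π σ v w) :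
    IsRemovablePair π σ w v := by
  obtain ⟨h1, f, h2, h3⟩ := h
  exact ⟨h1.symm, f, h2, by rw [h3, Set.pair_comm]⟩

/-- Let `{v, w}` be removable, leaving the simple `π`, and let `π` have no simple one-point
extension in `σ`. Once `v` is deleted, either `w` is on one side of everything else in both orders,
or `w` has a twin `u`; in the second case `u` can replace `w`, so `{v, u}` is removable as
well. -/
lemma IsRemovablePair.corner_or_step {π σ : FinPerm} (hπ : π.IsSimple)
    (hno : ¬ HasExtension π σ) {v w : Fin σ.size} (h : IsRemovablePair π σ v w) :
    (∀ a b, a ≠ v → a ≠ w → b ≠ v → b ≠ w → σ.Indist w a b) ∨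
      ∃ u, u ≠ v ∧ u ≠ w ∧ (∀ c, c ≠ u → c ≠ v → c ≠ w → σ.Indist c u w) ∧
        IsRemovablePair π σ v u := by
  obtain ⟨hvw, f, hf, hr⟩ := h
  have hX : σ.SimpleOn (Set.range f) := hf.simpleOn_range_iff.2 hπ
  have hw : w ∉ Set.range f := by rw [hr]; simp
  have hmem : ∀ x, x ∈ Set.range f ↔ x ≠ v ∧ x ≠ w := fun x => by rw [hr]; simp
  rcases hX.corner_or_twin hw (fun hs => hno (hf.hasExtension hw hs)) with h | ⟨u, hu, h⟩
  · left
    intro a b h1 h2 h3 h4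
    exact h.2 w (by simp) hw a ((hmem a).2 ⟨h1, h2⟩) b ((hmem b).2 ⟨h3, h4⟩)
  · right
    have huv := ((hmem u).1 hu).1
    have huw := ((hmem u).1 hu).2
    have htw : ∀ c, c ≠ u → c ≠ v → c ≠ w → σ.Indist c u w := fun c h1 h2 h3 =>
      h.2 c (Or.inr ((hmem c).2 ⟨h2, h3⟩)) (by simp [h1, h3]) u (by simp) w (by simp)
    refine ⟨u, huv, huw, htw, huv.symm, fun i => if f i = u then w else f i, ⟨?_, ?_⟩, ?_⟩
    · intro a b hab
      have hlt := hf.1 hab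
      have hfa := (hmem _).1 ⟨a, rfl⟩
      have hfb := (hmem _).1 ⟨b, rfl⟩
      dsimp only
      split_ifs with ha hb hb
      · rw [ha, hb] at hlt; exact absurd hlt (lt_irrefl _)
      · have := ((htw _ hb hfb.1 hfb.2).flip hb hfb.2).1
        rw [ha] at hlt; exact this.1 hlt
      · have := (htw _ ha hfa.1 hfa.2).1
        rw [hb] at hlt; exact this.1 hlt
      · exact hlt
    · intro a b
      rw [hf.2]
      have hfa := (hmem _).1 ⟨a, rfl⟩
      have hfb := (hmem _).1 ⟨b, rfl⟩
      dsimp only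
      split_ifs with ha hb hb
      · rw [ha, hb]; simp
      · rw [ha]; exact ((htw _ hb hfb.1 hfb.2).flip hb hfb.2).2
      · rw [hb]; exact (htw _ ha hfa.1 hfa.2).2
      · exact Iff.rfl
    · ext x
      simp only [Set.mem_range, Set.mem_compl_iff, Set.mem_insert_iff, Set.mem_singleton_iff,
        not_or]
      constructor
      · rintro ⟨i, rfl⟩
        split_ifs with hi
        · exact ⟨hvw.symm, huw.symm⟩
        · exact ⟨((hmem _).1 ⟨i, rfl⟩).1, hi⟩
      · rintro ⟨h1, h2⟩
        by_cases hxw : x = w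
        · obtain ⟨i, hi⟩ := hu
          exact ⟨i, by rw [if_pos hi, hxw]⟩
        · obtain ⟨i, hi⟩ := (hmem x).2 ⟨h1, hxw⟩
          exact ⟨i, by rw [hi, if_neg h2]⟩

/-- `u` and `w` become neighbours, or already are, when `v` is deleted. -/
def Near (v u w : ℕ) : Prop :=
  u + 1 = w ∨ w + 1 = u ∨ (u + 1 = v ∧ v + 1 = w) ∨ (w + 1 = v ∧ v + 1 = u)

lemma near_of_forall_lt_iff {n : ℕ} {u v w : Fin n} (huv : u ≠ v) (huw : u ≠ w) (hvw : v ≠ w)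
    (h : ∀ c, c ≠ u → c ≠ v → c ≠ w → (c < u ↔ c < w)) : Near v u w := by
  have key : ∀ u w : Fin n, u ≠ v → v ≠ w → u < w →
      (∀ c, c ≠ u → c ≠ v → c ≠ w → (c < u ↔ c < w)) →
      (u : ℕ) + 1 = w ∨ ((u : ℕ) + 1 = v ∧ (v : ℕ) + 1 = w) := by
    intro u w huv hvw hlt h
    have hw := w.2
    have h1 := h ⟨u + 1, by omega⟩
    simp only [ne_eq, Fin.ext_iff, Fin.lt_def] at *
    by_cases h2 : (u : ℕ) + 2 < n
    · have h3 := h ⟨u + 2, h2⟩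
      simp only at h3
      omega
    · omega
  rcases lt_or_gt_of_ne huw with hlt | hlt
  · rcases key u w huv hvw hlt h with h | h
    · exact Or.inl h
    · exact Or.inr (Or.inr (Or.inl h))
  · rcases key w u hvw.symm huv.symm hlt (fun c h1 h2 h3 => (h c h3 h2 h1).symm) with h | h
    · exact Or.inr (Or.inl h)
    · exact Or.inr (Or.inr (Or.inr h))

lemma near_of_twin {σ : FinPerm} {u v w : Fin σ.size} (huv : u ≠ v) (huw : u ≠ w) (hvw : v ≠ w)
    (h : ∀ c, c ≠ u → c ≠ v → c ≠ w → σ.Indist c u w) :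
    Near v u w ∧ Near (σ.2 v) (σ.2 u) (σ.2 w) := by
  refine ⟨near_of_forall_lt_iff huv huw hvw fun c h1 h2 h3 => (h c h1 h2 h3).1,
    near_of_forall_lt_iff (fun e => huv (σ.2.injective e)) (fun e => huw (σ.2.injective e))
      (fun e => hvw (σ.2.injective e)) fun c h1 h2 h3 => ?_⟩
  obtain ⟨c, rfl⟩ := σ.2.surjective c
  exact (h c (fun e => h1 (e ▸ rfl)) (fun e => h2 (e ▸ rfl)) (fun e => h3 (e ▸ rfl))).2

/-- Replacing an element of a removable pair by its twin, alternately on both sides, moves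
monotonically through the positions. It therefore stops, at a pair one of whose elements lies on
one side of everything else once the other is deleted. -/
lemma IsRemovablePair.exists_corner {π σ : FinPerm} (hπ : π.IsSimple) (hσ : σ.IsSimple)
    (hn : 4 ≤ σ.size) (hno : ¬ HasExtension π σ) {v₀ w₀ : Fin σ.size}
    (h₀ : IsRemovablePair π σ v₀ w₀) :
    ∃ v w, IsRemovablePair π σ v w ∧
      ∀ a b, a ≠ v → a ≠ w → b ≠ v → b ≠ w → σ.Indist w a b := by
  by_contra hcon
  push Not at hcon
  have hstep : ∀ v w, IsRemovablePair π σ v w → ∃ u, u ≠ v ∧ u ≠ w ∧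
      (∀ c, c ≠ u → c ≠ v → c ≠ w → σ.Indist c u w) ∧ IsRemovablePair π σ v u := by
    intro v w h
    rcases h.corner_or_step hπ hno with h' | h'
    · obtain ⟨a, b, h1, h2, h3, h4, h5⟩ := hcon v w h
      exact absurd (h' a b h1 h2 h3 h4) h5
    · exact h'
  -- the leftmost position `w` that lies in a removable pair
  obtain ⟨w, ⟨v, hvw⟩, hmin⟩ := (Set.toFinite {w | ∃ v, IsRemovablePair π σ v w}).exists_minimal
    ⟨w₀, v₀, h₀⟩
  have hmin' : ∀ x y, IsRemovablePair π σ x y → (w : ℕ) ≤ x ∧ (w : ℕ) ≤ y := by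
    intro x y hxy
    refine ⟨(le_total w x).elim id fun h => hmin ⟨y, hxy.symm⟩ h,
      (le_total w y).elim id fun h => hmin ⟨x, hxy⟩ h⟩
  obtain ⟨u, huv, huw, hu, hvu⟩ := hstep v w hvw
  obtain ⟨t, htw, htv, ht, hwt⟩ := hstep w v hvw.symm
  obtain ⟨s, hst, hsw, hs, hts⟩ := hstep t w hwt.symm
  have h1 := (near_of_twin huv huw hvw.1 hu).1
  have h2 := (near_of_twin htw htv hvw.1.symm ht).1
  have h3 := (near_of_twin hst hsw htw hs).1
  have m1 := hmin' _ _ hvu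
  have m2 := hmin' _ _ hts
  -- both twins of `w` are to its right, hence too close together
  have key : u = s ∨ u = t ∨ s = v := by
    have hvw' := hvw.1
    simp only [Near, ne_eq, Fin.ext_iff] at *
    omega
  rcases key with rfl | rfl | rfl
  · refine hσ.not_indist_pair (by omega) huw fun c h1 h2 => ?_
    by_cases hcv : c = v
    · exact hs c h1 (by rw [hcv]; exact htv.symm) h2
    · exact hu c h1 hcv h2
  · refine hσ.not_indist_triple hn (a := w) (b := u) (d := v) huw.symm fun c h1 h2 h3 => ?_
    exact ⟨(hu c h2 h3 h1).symm, ht c h2 h1 h3⟩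
  · refine hσ.not_indist_triple hn (a := w) (b := s) (d := t) hsw.symm fun c h1 h2 h3 => ?_
    exact ⟨(hs c h2 h3 h1).symm, (ht c h3 h1 h2).symm⟩

/-! ### Two-point extensions that admit no intermediate simple permutation -/

/-- There is a removable pair `{v, w}` such that, in the diagram without `v`, the point `w` is the
extreme one in both directions: leftmost if `p` holds and rightmost otherwise, lowest if `q` holds
and highest otherwise. -/
def HasCornerPair (p q : Prop) (π σ : FinPerm) : Prop :=
  ∃ v w, IsRemovablePair π σ v w ∧
    ∀ c, c ≠ v → c ≠ w → (w < c ↔ p) ∧ (σ.2 w < σ.2 c ↔ q)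

lemma IsRemovablePair.rev {π σ : FinPerm} {v w : Fin σ.size} (h : IsRemovablePair π σ v w) :
    IsRemovablePair π.rev σ.rev v.rev w.rev := by
  obtain ⟨h1, f, h2, h3⟩ := h
  refine ⟨fun e => h1 (Fin.rev_injective e), _, h2.rev, ?_⟩
  ext x
  have : x.rev ∈ Set.range f ↔ x.rev ∈ ({v, w}ᶜ : Set (Fin σ.size)) := by rw [h3]
  simp only [Set.mem_range, Set.mem_compl_iff, Set.mem_insert_iff, Set.mem_singleton_iff,
    not_or, Fin.rev_eq_iff] at this ⊢
  rw [← this]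
  constructor
  · rintro ⟨i, hi⟩
    exact ⟨i.rev, hi⟩
  · rintro ⟨i, hi⟩
    exact ⟨i.rev, (congrArg f (Fin.rev_rev i)).trans hi⟩

lemma IsRemovablePair.inv {π σ : FinPerm} {v w : Fin σ.size} (h : IsRemovablePair π σ v w) :
    IsRemovablePair π.inv σ.inv (σ.2 v) (σ.2 w) := by
  obtain ⟨h1, f, h2, h3⟩ := h
  refine ⟨fun e => h1 (σ.2.injective e), _, h2.inv, ?_⟩
  ext x
  have : σ.2.symm x ∈ Set.range f ↔ σ.2.symm x ∈ ({v, w}ᶜ : Set (Fin σ.size)) := by rw [h3]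
  simp only [Set.mem_range, Set.mem_compl_iff, Set.mem_insert_iff, Set.mem_singleton_iff,
    not_or, Equiv.symm_apply_eq] at this ⊢
  rw [← this]
  constructor
  · rintro ⟨i, rfl⟩
    exact ⟨π.2.symm i, (Equiv.symm_apply_apply _ _).symm⟩
  · rintro ⟨i, hi⟩
    exact ⟨π.2 i, by rw [Equiv.symm_apply_apply, hi, Equiv.apply_symm_apply]⟩

lemma HasCornerPair.rev {p q p' : Prop} {π σ : FinPerm} (h : HasCornerPair p q π σ)
    (hp : p' ↔ ¬ p) : HasCornerPair p' q π.rev σ.rev := by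
  obtain ⟨v, w, h1, h2⟩ := h
  refine ⟨_, _, h1.rev, fun c hv hw => ?_⟩
  have hv' : c.rev ≠ v := fun e => hv (Fin.rev_eq_iff.1 e)
  have hw' : c.rev ≠ w := fun e => hw (Fin.rev_eq_iff.1 e)
  obtain ⟨h3, h4⟩ := h2 c.rev hv' hw'
  refine ⟨?_, ?_⟩
  · rw [hp, ← h3, Fin.rev_lt_iff]
    grind
  · have e : σ.rev.2 w.rev = σ.2 w := congrArg σ.2 (Fin.rev_rev w)
    rw [e]
    exact h4

lemma HasCornerPair.inv {p q : Prop} {π σ : FinPerm} (h : HasCornerPair p q π σ) :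
    HasCornerPair q p π.inv σ.inv := by
  obtain ⟨v, w, h1, h2⟩ := h
  refine ⟨_, _, h1.inv, fun c hv hw => ?_⟩
  obtain ⟨c, rfl⟩ := σ.2.surjective c
  obtain ⟨h3, h4⟩ := h2 c (fun e => hv (e ▸ rfl)) (fun e => hw (e ▸ rfl))
  refine ⟨h4, ?_⟩
  simpa using h3

/-- The initial position in the description of a critical extension: the removable points `z₀`
and `z₁` have the values `0` and `1`, and `z₁` is the first position. -/
def HasInitialPair (π σ : FinPerm) : Prop :=
  ∃ z₀ z₁, IsRemovablePair π σ z₀ z₁ ∧ (z₁ : ℕ) = 0 ∧ (σ.2 z₁ : ℕ) = 1 ∧ (σ.2 z₀ : ℕ) = 0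

lemma HasCornerPair.hasInitialPair {π σ : FinPerm} (hσ : σ.IsSimple) (hn : 4 ≤ σ.size)
    (h : HasCornerPair True True π σ) :
    HasInitialPair π σ ∨ HasInitialPair π.inv σ.inv := by
  obtain ⟨v, w, h1, h2⟩ := h
  simp only [iff_true] at h2
  have hvw := h1.1
  have hval : ∀ τ : FinPerm, 4 ≤ τ.size → ∀ v w : Fin τ.size, v ≠ w →
      (∀ c, c ≠ v → c ≠ w → w < c ∧ τ.2 w < τ.2 c) → w < v → τ.2 v < τ.2 w →
      (w : ℕ) = 0 ∧ (τ.2 w : ℕ) = 1 ∧ (τ.2 v : ℕ) = 0 := by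
    intro τ hn v w hvw h2 h3 h4
    have a1 := h2 ⟨0, by omega⟩
    have a2 := h2 (τ.2.symm ⟨0, by omega⟩)
    have a3 := h2 (τ.2.symm ⟨1, by omega⟩)
    rw [ne_eq, ne_eq, Equiv.symm_apply_eq, Equiv.symm_apply_eq, Equiv.apply_symm_apply] at a2 a3
    simp only [ne_eq, Fin.ext_iff, Fin.lt_def] at *
    omega
  have hvw' : σ.2 v ≠ σ.2 w := fun e => hvw (σ.2.injective e)
  rcases lt_or_gt_of_ne hvw with h3 | h3 <;> rcases lt_or_gt_of_ne hvw' with h4 | h4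
  · refine absurd (fun a b ha hb => ?_) (hσ.not_corner (by omega) v)
    have key : ∀ c, c ≠ v → v < c ∧ σ.2 v < σ.2 c := fun c hc => by
      by_cases hcw : c = w
      · subst hcw; exact ⟨h3, h4⟩
      · exact ⟨h3.trans (h2 c hc hcw).1, h4.trans (h2 c hc hcw).2⟩
    exact ⟨iff_of_true (key a ha).1 (key b hb).1, iff_of_true (key a ha).2 (key b hb).2⟩
  · right
    refine ⟨_, _, h1.inv, ?_⟩
    refine hval σ.inv hn (σ.2 v) (σ.2 w) hvw' ?_ h4 (by simpa using h3)
    intro c hv hw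
    obtain ⟨c, rfl⟩ := σ.2.surjective c
    have := h2 c (fun e => hv (e ▸ rfl)) (fun e => hw (e ▸ rfl))
    exact ⟨this.2, by simpa using this.1⟩
  · left
    exact ⟨_, _, h1, hval σ hn v w hvw h2 h3 h4⟩
  · refine absurd (fun a b ha hb => ?_) (hσ.not_corner (by omega) w)
    have key : ∀ c, c ≠ w → w < c ∧ σ.2 w < σ.2 c := fun c hc => by
      by_cases hcv : c = v
      · subst hcv; exact ⟨h3, h4⟩
      · exact h2 c hcv hc
    exact ⟨iff_of_true (key a ha).1 (key b hb).1, iff_of_true (key a ha).2 (key b hb).2⟩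

lemma IsRemovablePair.exists_hasInitialPair {π σ : FinPerm} (hπ : π.IsSimple) (hσ : σ.IsSimple)
    (hn : 4 ≤ σ.size) (hno : ¬ HasExtension π σ) {v₀ w₀ : Fin σ.size}
    (h₀ : IsRemovablePair π σ v₀ w₀) : ∃ g, IsDihedral g ∧ HasInitialPair (g π) (g σ) := by
  obtain ⟨v, w, h, hc⟩ := h₀.exists_corner hπ hσ hn hno
  obtain ⟨d, hdv, hdw⟩ : ∃ d, d ≠ v ∧ d ≠ w := by
    by_contra! hcon
    refine hσ.not_indist_pair (by omega) h.1 fun c h1 h2 => absurd (hcon c h1) h2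
  have hc' : HasCornerPair (w < d) (σ.2 w < σ.2 d) π σ :=
    ⟨v, w, h, fun c h1 h2 => hc c d h1 h2 hdv hdw⟩
  have key : ∃ g, IsDihedral g ∧ HasCornerPair True True (g π) (g σ) := by
    by_cases h1 : w < d <;> by_cases h2 : σ.2 w < σ.2 d <;> simp only [h1, h2] at hc'
    · exact ⟨_, .id, hc'⟩
    · exact ⟨_, .rev (.inv .id), hc'.inv.rev (by simp)⟩
    · exact ⟨_, .rev .id, hc'.rev (by simp)⟩
    · exact ⟨_, .rev (.inv (.rev .id)), (hc'.rev (p' := True) (by simp)).inv.rev (by simp)⟩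
  obtain ⟨g, hg, hgc⟩ := key
  rcases hgc.hasInitialPair (hg.isSimple hσ) (by rw [hg.size_eq]; exact hn) with h | h
  · exact ⟨g, hg, h⟩
  · exact ⟨_, hg.inv, h⟩

/-- The first `2 * r` values of `σ` zigzag: the odd ones occupy the first `r` positions in
increasing order, the even ones are consecutive, in increasing or decreasing order, and the two
largest of these values form a removable pair. -/
structure IsZigzag (π σ : FinPerm) (r : ℕ) : Prop where
  odd : ∀ a : Fin σ.size, (a : ℕ) < r → (σ.2 a : ℕ) = 2 * a + 1
  even : ∃ b : ℕ, (∀ a : Fin σ.size, ∀ c < r, (σ.2 a : ℕ) = 2 * c → (a : ℕ) = b + c) ∨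
    ∀ a : Fin σ.size, ∀ c < r, (σ.2 a : ℕ) = 2 * c → (a : ℕ) + c = b
  pair : ∀ v w : Fin σ.size, (σ.2 v : ℕ) + 1 = 2 * r → (σ.2 w : ℕ) + 2 = 2 * r →
    IsRemovablePair π σ v w

lemma eq_of_val_eq {σ : FinPerm} {a b : Fin σ.size} (h : (σ.2 a : ℕ) = σ.2 b) : a = b :=
  σ.2.injective (Fin.ext h)

lemma val_apply_lt (σ : FinPerm) (a : Fin σ.size) : (σ.2 a : ℕ) < σ.size := (σ.2 a).2

lemma exists_val_eq (σ : FinPerm) {k : ℕ} (h : k < σ.size) : ∃ a, (σ.2 a : ℕ) = k :=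
  ⟨σ.2.symm ⟨k, h⟩, by simp⟩

lemma HasInitialPair.isZigzag {π σ : FinPerm} (h : HasInitialPair π σ) : IsZigzag π σ 1 := by
  obtain ⟨z₀, z₁, h1, h2, h3, h4⟩ := h
  refine ⟨fun a ha => ?_, ⟨z₀, Or.inl fun a c hc ha => ?_⟩, fun v w hv hw => ?_⟩
  · obtain rfl : a = z₁ := Fin.ext (by omega)
    omega
  · obtain rfl : a = z₀ := eq_of_val_eq (by omega)
    omega
  · obtain rfl : v = z₁ := eq_of_val_eq (by omega)
    obtain rfl : w = z₀ := eq_of_val_eq (by omega)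
    exact h1.symm

lemma IsZigzag.eq_of_odd {π σ : FinPerm} {r : ℕ} (h : IsZigzag π σ r) {a : Fin σ.size} {k : ℕ}
    (hk : k < r) (hr : 2 * r ≤ σ.size) (ha : (σ.2 a : ℕ) = 2 * k + 1) : (a : ℕ) = k := by
  have := h.odd ⟨k, by omega⟩ hk
  have e : a = ⟨k, by omega⟩ := eq_of_val_eq (by rw [ha, this])
  rw [e]

/-- The next even value of a zigzag continues the run of even values. -/
lemma IsZigzag.exists_next_even {π σ : FinPerm} (hπ : π.IsSimple) (hσ : σ.IsSimple)
    (hn : 4 ≤ σ.size) (hno : ¬ HasExtension π σ) {r : ℕ} (hr : 1 ≤ r) (h : IsZigzag π σ r)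
    (hlt : 2 * r < σ.size) {v w : Fin σ.size} (hv : (σ.2 v : ℕ) + 1 = 2 * r)
    (hw : (σ.2 w : ℕ) + 2 = 2 * r) :
    ∃ u, (σ.2 u : ℕ) = 2 * r ∧ ((u : ℕ) + 1 = w ∨ (w : ℕ) + 1 = u) ∧ r ≤ (u : ℕ) ∧
      (∀ c, c ≠ u → c ≠ v → c ≠ w → σ.Indist c u w) ∧ IsRemovablePair π σ v u := by
  have hvr : (v : ℕ) + 1 = r := by
    have := h.eq_of_odd (a := v) (k := r - 1) (by omega) (by omega) (by omega)
    omega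
  have hwr : r ≤ (w : ℕ) := by
    by_contra hc
    have := h.odd w (by omega)
    omega
  have hp := h.pair v w hv hw
  obtain ⟨e, he⟩ := exists_val_eq σ hlt
  have hev : e ≠ v := fun e' => by subst e'; omega
  have hew : e ≠ w := fun e' => by subst e'; omega
  rcases hp.corner_or_step hπ hno with hc | ⟨u, huv, huw, hu, hvu⟩
  · exfalso
    rcases Nat.lt_or_ge 1 r with h1 | h1
    · -- the value `0` is below `w`, the value `2 * r` above it
      obtain ⟨d, hd⟩ := exists_val_eq σ (k := 0) (by omega)
      have := (hc e d hev hew (fun e' => by subst e'; omega) (fun e' => by subst e'; omega)).2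
      rw [Fin.lt_def, Fin.lt_def] at this
      omega
    · obtain rfl : r = 1 := by omega
      by_cases hw1 : (w : ℕ) = 1
      · refine hσ.not_indist_pair (by omega) hp.1 fun c h1 h2 => ⟨?_, ?_⟩
        · simp only [ne_eq, Fin.ext_iff, Fin.lt_def] at *
          omega
        · have hcv : (σ.2 c : ℕ) ≠ σ.2 v := fun e => h1 (eq_of_val_eq e)
          have hcw : (σ.2 c : ℕ) ≠ σ.2 w := fun e => h2 (eq_of_val_eq e)
          simp only [Fin.lt_def]
          omega
      · refine hσ.not_corner (by omega) w fun a b ha hb => ⟨?_, ?_⟩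
        · have key : ∀ a, a ≠ w → a < w := by
            intro a haw
            by_cases hav : a = v
            · subst hav; rw [Fin.lt_def]; omega
            · have := (hc a ⟨1, by omega⟩ hav haw (by simp only [ne_eq, Fin.ext_iff]; omega)
                (by simp only [ne_eq, Fin.ext_iff]; omega)).1
              simp only [ne_eq, Fin.ext_iff, Fin.lt_def] at *
              omega
          exact iff_of_false (not_lt.2 (key a ha).le) (not_lt.2 (key b hb).le)
        · have haw : (σ.2 a : ℕ) ≠ σ.2 w := fun e => ha (eq_of_val_eq e)
          have hbw : (σ.2 b : ℕ) ≠ σ.2 w := fun e => hb (eq_of_val_eq e)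
          simp only [Fin.lt_def]
          omega
  · obtain ⟨n1, n2⟩ := near_of_twin huv huw hp.1 hu
    have huv' : (σ.2 u : ℕ) ≠ σ.2 v := fun e => huv (eq_of_val_eq e)
    have huv'' : (u : ℕ) ≠ v := fun e => huv (Fin.ext e)
    have huval : (σ.2 u : ℕ) = 2 * r := by
      by_contra hne
      have hu3 : (σ.2 u : ℕ) + 3 = 2 * r := by
        unfold Near at n2
        omega
      have hur : (u : ℕ) + 2 = r := by
        have := h.eq_of_odd (a := u) (k := r - 2) (by omega) (by omega) (by omega)
        omega
      have hw' : (w : ℕ) = r := by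
        unfold Near at n1
        omega
      -- `u`, `v`, `w` fill three consecutive positions and three consecutive values
      refine hσ.not_indist_triple hn huv (d := w) fun c h1 h2 h3 => ?_
      have h1' : (σ.2 c : ℕ) ≠ σ.2 u := fun e => h1 (eq_of_val_eq e)
      have h2' : (σ.2 c : ℕ) ≠ σ.2 v := fun e => h2 (eq_of_val_eq e)
      have h3' : (σ.2 c : ℕ) ≠ σ.2 w := fun e => h3 (eq_of_val_eq e)
      simp only [Indist, ne_eq, Fin.ext_iff, Fin.lt_def] at *
      omega
    have hur : r ≤ (u : ℕ) := by
      by_contra hc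
      have := h.odd u (by omega)
      omega
    refine ⟨u, huval, ?_, hur, hu, hvu⟩
    unfold Near at n1
    omega

/-- In a simple permutation the last position, here `z`, does not hold the largest or the smallest
value. -/
lemma IsSimple.not_last_extreme {σ : FinPerm} (hσ : σ.IsSimple) (hn : 3 ≤ σ.size) {z : Fin σ.size}
    (hz : ∀ a, a ≠ z → a < z)
    (hv : (∀ a, (σ.2 a : ℕ) ≤ σ.2 z) ∨ ∀ a, (σ.2 z : ℕ) ≤ σ.2 a) : False := by
  refine hσ.not_corner hn z fun a b ha hb => ⟨?_, ?_⟩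
  · exact iff_of_false (not_lt.2 (hz a ha).le) (not_lt.2 (hz b hb).le)
  · have h1 : (σ.2 a : ℕ) ≠ σ.2 z := fun e => ha (eq_of_val_eq e)
    have h2 : (σ.2 b : ℕ) ≠ σ.2 z := fun e => hb (eq_of_val_eq e)
    simp only [Fin.lt_def]
    rcases hv with hv | hv
    · have := hv a; have := hv b; omega
    · have := hv a; have := hv b; omega

/-- A zigzag that does not yet exhaust the values extends by one odd and one even value. In particular
a critical extension has even size. -/
lemma IsZigzag.step {π σ : FinPerm} (hπ : π.IsSimple) (hσ : σ.IsSimple)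
    (hn : 4 ≤ σ.size) (hno : ¬ HasExtension π σ) {r : ℕ} (hr : 1 ≤ r) (h : IsZigzag π σ r)
    (hlt : 2 * r < σ.size) : 2 * (r + 1) ≤ σ.size ∧ IsZigzag π σ (r + 1) := by
  obtain ⟨v, hv⟩ := exists_val_eq σ (k := 2 * r - 1) (by omega)
  obtain ⟨w, hw⟩ := exists_val_eq σ (k := 2 * r - 2) (by omega)
  obtain ⟨u, hu, huw, hur, htw, hvu⟩ := h.exists_next_even hπ hσ hn hno hr hlt
    (v := v) (w := w) (by omega) (by omega)
  have hvr : (v : ℕ) + 1 = r := by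
    have := h.eq_of_odd (a := v) (k := r - 1) (by omega) (by omega) (by omega)
    omega
  have hwr : r ≤ (w : ℕ) := by
    by_contra hc
    have := h.odd w (by omega)
    omega
  have heven : ∃ b : ℕ,
      (∀ a : Fin σ.size, ∀ c < r + 1, (σ.2 a : ℕ) = 2 * c → (a : ℕ) = b + c) ∨
      ∀ a : Fin σ.size, ∀ c < r + 1, (σ.2 a : ℕ) = 2 * c → (a : ℕ) + c = b := by
    have hau : ∀ a : Fin σ.size, (σ.2 a : ℕ) = 2 * r → a = u := fun a ha => eq_of_val_eq (by omega)
    obtain ⟨b, hb | hb⟩ := h.even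
    · have hwb := hb w (r - 1) (by omega) (by omega)
      rcases huw with h1 | h1
      · rcases Nat.lt_or_ge 1 r with h2 | h2
        · -- the place before `w` is taken by the preceding even value
          exfalso
          obtain ⟨d, hd⟩ := exists_val_eq σ (k := 2 * (r - 2)) (by omega)
          have hdb := hb d (r - 2) (by omega) hd
          have : d = u := Fin.ext (by omega)
          subst this
          omega
        · refine ⟨w, Or.inr fun a c hc ha => ?_⟩
          rcases Nat.lt_or_ge c r with h3 | h3
          · have := hb a c h3 ha
            omega
          · obtain rfl := hau a (by omega)
            omega
      · refine ⟨b, Or.inl fun a c hc ha => ?_⟩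
        rcases Nat.lt_or_ge c r with h3 | h3
        · exact hb a c h3 ha
        · obtain rfl := hau a (by omega)
          omega
    · have hwb := hb w (r - 1) (by omega) (by omega)
      rcases huw with h1 | h1
      · refine ⟨b, Or.inr fun a c hc ha => ?_⟩
        rcases Nat.lt_or_ge c r with h3 | h3
        · exact hb a c h3 ha
        · obtain rfl := hau a (by omega)
          omega
      · rcases Nat.lt_or_ge 1 r with h2 | h2
        · exfalso
          obtain ⟨d, hd⟩ := exists_val_eq σ (k := 2 * (r - 2)) (by omega)
          have hdb := hb d (r - 2) (by omega) hd
          have : d = u := Fin.ext (by omega)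
          subst this
          omega
        · refine ⟨w, Or.inl fun a c hc ha => ?_⟩
          rcases Nat.lt_or_ge c r with h3 | h3
          · have := hb a c h3 ha
            omega
          · obtain rfl := hau a (by omega)
            omega
  have hle : 2 * (r + 1) ≤ σ.size := by
    -- otherwise the run of even values reaches the last position with the value `2 * r` or `0`
    by_contra hc
    have hcase : ∀ a : Fin σ.size, (a : ℕ) < r ∨ ∃ c < r + 1, (σ.2 a : ℕ) = 2 * c := by
      intro a
      have ha := σ.val_apply_lt a
      rcases Nat.even_or_odd' (σ.2 a : ℕ) with ⟨k, hk | hk⟩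
      · exact Or.inr ⟨k, by omega, hk⟩
      · left
        have := h.eq_of_odd (a := a) (k := k) (by omega) (by omega) hk
        omega
    obtain ⟨b, hb | hb⟩ := heven
    · have hub := hb u r (by omega) hu
      refine hσ.not_last_extreme (by omega) (z := u) (fun a ha => ?_) (Or.inl fun a => ?_)
      · rw [Fin.lt_def]
        have ha' : (a : ℕ) ≠ u := fun e => ha (Fin.ext e)
        rcases hcase a with h1 | ⟨c, h1, h2⟩
        · omega
        · have := hb a c h1 h2
          omega
      · have := σ.val_apply_lt a
        omega
    · obtain ⟨z, hz⟩ := exists_val_eq σ (k := 0) (by omega)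
      have hzb := hb z 0 (by omega) (by omega)
      have hzr : r ≤ (z : ℕ) := by
        by_contra hc
        have := h.odd z (by omega)
        omega
      refine hσ.not_last_extreme (by omega) (z := z) (fun a ha => ?_) (Or.inr fun a => by omega)
      rw [Fin.lt_def]
      have ha' : (a : ℕ) ≠ z := fun e => ha (Fin.ext e)
      rcases hcase a with h1 | ⟨c, h1, h2⟩
      · omega
      · have := hb a c h1 h2
        omega
  refine ⟨hle, ?_⟩
  obtain ⟨t, ht, htr, hut⟩ : ∃ t, (σ.2 t : ℕ) = 2 * r + 1 ∧ (t : ℕ) = r ∧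
      IsRemovablePair π σ u t := by
    rcases hvu.symm.corner_or_step hπ hno with hc | ⟨t, htu, htv, ht, hut⟩
    · exfalso
      obtain ⟨e, he⟩ := exists_val_eq σ (k := 2 * r + 1) (by omega)
      have := (hc e w (fun e' => by subst e'; omega) (fun e' => by subst e'; omega)
        (fun e' => by subst e'; omega) (fun e' => by subst e'; omega)).2
      rw [Fin.lt_def, Fin.lt_def] at this
      omega
    · obtain ⟨n1, n2⟩ := near_of_twin htu htv hvu.1.symm ht
      have htu' : (σ.2 t : ℕ) ≠ σ.2 u := fun e => htu (eq_of_val_eq e)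
      have hne : t ≠ w := by
        rintro rfl
        refine hσ.not_indist_triple hn (a := u) (b := t) (d := v) htu.symm fun c h1 h2 h3 => ?_
        exact ⟨htw c h1 h3 h2, ht c h2 h1 h3⟩
      have hne' : (σ.2 t : ℕ) ≠ σ.2 w := fun e => hne (eq_of_val_eq e)
      have hne'' : (t : ℕ) ≠ w := fun e => hne (Fin.ext e)
      have htval : (σ.2 t : ℕ) = 2 * r + 1 := by
        unfold Near at n2
        omega
      have htr : r ≤ (t : ℕ) := by
        by_contra hc
        have := h.odd t (by omega)
        omega
      refine ⟨t, htval, ?_, hut⟩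
      unfold Near at n1
      omega
  refine ⟨fun a ha => ?_, heven, fun v' w' hv' hw' => ?_⟩
  · rcases Nat.lt_or_ge (a : ℕ) r with h1 | h1
    · exact h.odd a h1
    · obtain rfl : a = t := Fin.ext (by omega)
      omega
  · obtain rfl : v' = t := eq_of_val_eq (by omega)
    obtain rfl : w' = u := eq_of_val_eq (by omega)
    exact hut.symm

/-- Deleting from `typeOne (m + 1)` the positions `c` and `m + 1 + d`, where `d` is `c` or `c + 1`,
leaves `typeOne m`. The two deleted values are `c + d` and `c + d + 1`. -/
lemma isEmbedding_typeOne_succ {m c d : ℕ} (hd : d ≤ m) (hcd : c ≤ d) (hdc : d ≤ c + 1) :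
    ∃ f, IsEmbedding (typeOne m) (typeOne (m + 1)) f ∧
      (∀ x, x ∈ Set.range f ↔ (x : ℕ) ≠ c ∧ (x : ℕ) ≠ m + 1 + d) ∧
      (∀ a, (f a : ℕ) = if (a : ℕ) < c then (a : ℕ) else if (a : ℕ) < m + d then a + 1 else a + 2) ∧
      ∀ a, ((typeOne (m + 1)).2 (f a) : ℕ) =
        if ((typeOne m).2 a : ℕ) < c + d then ((typeOne m).2 a : ℕ)
        else ((typeOne m).2 a : ℕ) + 2 := by
  have hlt : ∀ i : Fin (typeOne m).size, (i : ℕ) < 2 * m := fun i => i.2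
  let f : Fin (typeOne m).size → Fin (typeOne (m + 1)).size := fun i =>
    ⟨if (i : ℕ) < c then (i : ℕ) else if (i : ℕ) < m + d then i + 1 else i + 2, by
      have := hlt i
      change _ < 2 * _
      split_ifs <;> omega⟩
  have hf : ∀ a, (f a : ℕ) =
      if (a : ℕ) < c then (a : ℕ) else if (a : ℕ) < m + d then a + 1 else a + 2 := fun _ => rfl
  have hv : ∀ a, ((typeOne (m + 1)).2 (f a) : ℕ) =
      if ((typeOne m).2 a : ℕ) < c + d then ((typeOne m).2 a : ℕ)
        else ((typeOne m).2 a : ℕ) + 2 := by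
    intro a
    have := hlt a
    rw [typeOne_apply, typeOne_apply, hf]
    split_ifs <;> omega
  refine ⟨f, ⟨fun a b hab => ?_, fun a b => ?_⟩, fun x => ?_, hf, hv⟩
  · rw [Fin.lt_def] at hab ⊢
    rw [hf, hf]
    split_ifs <;> omega
  · rw [Fin.lt_def, Fin.lt_def, hv, hv]
    split_ifs <;> omega
  · have hx : (x : ℕ) < 2 * (m + 1) := x.2
    constructor
    · rintro ⟨i, rfl⟩
      have := hlt i
      rw [hf]
      split_ifs <;> omega
    · rintro ⟨h1, h2⟩
      refine ⟨⟨if (x : ℕ) < c then (x : ℕ) else if (x : ℕ) < m + 1 + d then x - 1 else x - 2, ?_⟩,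
        ?_⟩
      · change _ < 2 * _; split_ifs <;> omega
      · ext
        rw [hf]
        dsimp only
        split_ifs <;> omega

/-- Starting from its initial pair, the zigzag grows until it is all of `σ`; this identifies `σ` and
`π`. -/
lemma HasInitialPair.eq_typeOne {π σ : FinPerm} (hπ : π.IsSimple) (hσ : σ.IsSimple)
    (hn : 5 ≤ σ.size) (hno : ¬ HasExtension π σ) (h : HasInitialPair π σ) :
    ∃ m, 2 ≤ m ∧ σ = typeOne (m + 1) ∧ π = typeOne m := by
  have hz : ∀ r, 1 ≤ r → 2 * r ≤ σ.size → IsZigzag π σ r := by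
    intro r hr
    induction r, hr using Nat.le_induction with
    | base => exact fun _ => h.isZigzag
    | succ r hr ih =>
      intro hle
      exact ((ih (by omega)).step hπ hσ (by omega) hno hr (by omega)).2
  obtain ⟨r, hr1, hr⟩ : ∃ r, 1 ≤ r ∧ σ.size = 2 * r := by
    refine ⟨σ.size / 2, by omega, ?_⟩
    by_contra hc
    have := ((hz (σ.size / 2) (by omega) (by omega)).step hπ hσ (by omega) hno (by omega)
      (by omega)).1
    omega
  have hzr := hz r hr1 hr.ge
  obtain ⟨z, hz0⟩ := exists_val_eq σ (k := 0) (by omega)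
  have hzge : r ≤ (z : ℕ) := by
    by_contra hc
    have := hzr.odd z (by omega)
    omega
  have heven : ∀ a : Fin σ.size, r ≤ (a : ℕ) → ∃ c < r, (σ.2 a : ℕ) = 2 * c := by
    intro a ha
    have ha' := σ.val_apply_lt a
    rcases Nat.even_or_odd' (σ.2 a : ℕ) with ⟨k, hk | hk⟩
    · exact ⟨k, by omega, hk⟩
    · have := hzr.eq_of_odd (a := a) (k := k) (by omega) (by omega) hk
      omega
  have hσ1 : σ = typeOne r := by
    refine eq_of_forall_val_eq hr fun i j hij => ?_
    rw [typeOne_apply, ← hij]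
    split_ifs with hi
    · exact hzr.odd i hi
    · obtain ⟨c, hc, hic⟩ := heven i (by omega)
      obtain ⟨b, hb | hb⟩ := hzr.even
      · have h1 := hb i c hc hic
        have h2 := hb z 0 (by omega) hz0
        obtain ⟨y, hy⟩ := exists_val_eq σ (k := 2 * (r - 1)) (by omega)
        have h3 := hb y (r - 1) (by omega) hy
        have := y.2
        omega
      · exfalso
        have h2 := hb z 0 (by omega) hz0
        refine hσ.not_last_extreme (by omega) (z := z) (fun a ha => ?_) (Or.inr fun a => by omega)
        rw [Fin.lt_def]
        have ha' : (a : ℕ) ≠ z := fun e => ha (Fin.ext e)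
        rcases Nat.lt_or_ge (a : ℕ) r with h1 | h1
        · omega
        · obtain ⟨c, hc, hac⟩ := heven a h1
          have := hb a c hc hac
          omega
  obtain ⟨m, rfl⟩ : ∃ m, r = m + 1 := ⟨r - 1, by omega⟩
  refine ⟨m, by omega, hσ1, ?_⟩
  subst hσ1
  obtain ⟨z₀, z₁, ⟨-, f, hf, hfr⟩, h2, -, h4⟩ := h
  obtain ⟨g, hg, hgr, -⟩ := isEmbedding_typeOne_succ (m := m) (c := 0) (d := 0) (by omega) le_rfl
    (by omega)
  refine hf.eq_of_range_eq hg ?_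
  ext x
  rw [hgr, hfr]
  have h0 : (z₀ : ℕ) = m + 1 := by
    rw [typeOne_apply] at h4
    split_ifs at h4
    omega
  simp only [Set.mem_compl_iff, Set.mem_insert_iff, Set.mem_singleton_iff, not_or, Fin.ext_iff]
  omega

/-- A simple permutation that extends the simple `π` by two points, with no simple permutation of
the intermediate size in between, is exceptional, and `π` is the next smaller exceptional
permutation of the same type. -/
theorem IsPattern.exists_dihedral_typeOne {π σ : FinPerm} (hπ : π.IsSimple) (hσ : σ.IsSimple)
    (h3 : 3 ≤ π.size) (hs : σ.size = π.size + 2) (hp : π.IsPattern σ)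
    (hno : ¬ HasExtension π σ) :
    ∃ g, IsDihedral g ∧ ∃ m, 2 ≤ m ∧ g σ = typeOne (m + 1) ∧ g π = typeOne m := by
  obtain ⟨f, hf⟩ := hp
  have hc : ((Set.range f)ᶜ).ncard = 2 := by
    have h1 := Set.ncard_add_ncard_compl (Set.range f)
    rw [IsEmbedding.ncard_range hf, Nat.card_fin] at h1
    omega
  obtain ⟨v, w, hvw, he⟩ := Set.ncard_eq_two.1 hc
  have h0 : IsRemovablePair π σ v w := ⟨hvw, f, hf, by rw [← he, compl_compl]⟩
  obtain ⟨g, hg, hi⟩ := h0.exists_hasInitialPair hπ hσ (by omega) hno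
  obtain ⟨g', hg', h1, -⟩ := hg.exists_inverse
  refine ⟨g, hg, hi.eq_typeOne (hg.isSimple hπ) (hg.isSimple hσ) (by rw [hg.size_eq]; omega)
    fun h => hno ?_⟩
  have := hg'.hasExtension h
  rwa [h1, h1] at this

/-! ### One-point extensions of exceptional permutations -/

/-- Relative to the occurrence of `π` in `σ` given by `f`, the point `p` lies in column `i` and
row `j` of the grid of gaps: `i` positions and `j` values of `π` precede it. -/
structure IsSlot (π σ : FinPerm) (f : Fin π.size → Fin σ.size) (p : Fin σ.size) (i j : ℕ) :
    Prop where
  notMem : p ∉ Set.range f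
  le_pos : i ≤ π.size
  le_val : j ≤ π.size
  pos : ∀ a, p < f a ↔ i ≤ (a : ℕ)
  val : ∀ a, σ.2 p < σ.2 (f a) ↔ j ≤ (π.2 a : ℕ)

/-- A point in column `i` and row `j` is neither beyond a corner of the diagram of `π` nor adjacent
to a point of `π` in both directions. These are the points whose addition keeps `π` simple. -/
def IsGoodSlot (π : FinPerm) (i j : ℕ) : Prop :=
  ¬ ((i = 0 ∨ i = π.size) ∧ (j = 0 ∨ j = π.size)) ∧
    ∀ a : Fin π.size, ¬ ((i = a ∨ i = a + 1) ∧ (j = π.2 a ∨ j = π.2 a + 1))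

lemma exists_threshold {N : ℕ} {P : Fin N → Prop} (h : ∀ a b, a ≤ b → P a → P b) :
    ∃ i ≤ N, ∀ a, P a ↔ i ≤ (a : ℕ) := by
  classical
  by_cases hP : ∃ k, ∃ hk : k < N, P ⟨k, hk⟩
  · obtain ⟨hk, hPk⟩ := Nat.find_spec hP
    refine ⟨Nat.find hP, hk.le, fun a => ⟨fun ha => Nat.find_min' hP ⟨a.2, ha⟩, fun ha => ?_⟩⟩
    exact h ⟨_, hk⟩ a ha hPk
  · push Not at hP
    exact ⟨N, le_rfl, fun a => iff_of_false (hP a a.2) (not_le.2 a.2)⟩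

lemma IsEmbedding.exists_isSlot {π σ : FinPerm} {f : Fin π.size → Fin σ.size}
    (hf : IsEmbedding π σ f) {p : Fin σ.size} (hp : p ∉ Set.range f) :
    ∃ i j, IsSlot π σ f p i j := by
  obtain ⟨i, hi, hi'⟩ := exists_threshold (P := fun a => p < f a)
    fun a b hab h => h.trans_le (hf.1.monotone hab)
  obtain ⟨j, hj, hj'⟩ := exists_threshold (P := fun v => σ.2 p < σ.2 (f (π.2.symm v)))
    fun a b hab h => by
      rcases hab.eq_or_lt with rfl | hab
      · exact h
      · exact h.trans ((hf.2 _ _).1 (by simpa using hab))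
  refine ⟨i, j, hp, hi, hj, hi', fun a => ?_⟩
  have := hj' (π.2 a)
  rwa [Equiv.symm_apply_apply] at this

lemma IsSlot.lt_pos {π σ : FinPerm} {f : Fin π.size → Fin σ.size} {p : Fin σ.size} {i j : ℕ}
    (h : IsSlot π σ f p i j) (a : Fin π.size) : f a < p ↔ (a : ℕ) < i := by
  have h1 : f a ≠ p := fun e => h.notMem ⟨a, e⟩
  rw [← not_le (a := i), ← h.pos a, not_lt]
  exact ⟨fun h => h.le, fun h => lt_of_le_of_ne h h1⟩

lemma IsSlot.lt_val {π σ : FinPerm} {f : Fin π.size → Fin σ.size} {p : Fin σ.size} {i j : ℕ}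
    (h : IsSlot π σ f p i j) (a : Fin π.size) : σ.2 (f a) < σ.2 p ↔ (π.2 a : ℕ) < j := by
  have h1 : σ.2 (f a) ≠ σ.2 p := fun e => h.notMem ⟨a, σ.2.injective e⟩
  rw [← not_le (a := j), ← h.val a, not_lt]
  exact ⟨fun h => h.le, fun h => lt_of_le_of_ne h h1⟩

lemma IsSlot.isGoodSlot {π σ : FinPerm} (hσ : σ.IsSimple) (hn : 3 ≤ σ.size)
    {f : Fin π.size → Fin σ.size} (hf : IsEmbedding π σ f) {p : Fin σ.size} {i j : ℕ}
    (h : IsSlot π σ f p i j) (hs : σ.size = π.size + 1) : IsGoodSlot π i j := by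
  have huniv : ∀ x, x = p ∨ ∃ a, x = f a := by
    have : insert p (Set.range f) = Set.univ := by
      refine Set.eq_of_subset_of_ncard_le (Set.subset_univ _) ?_
      rw [Set.ncard_insert_of_notMem h.notMem, hf.ncard_range, Set.ncard_univ, Nat.card_fin]
      omega
    intro x
    have hx : x ∈ insert p (Set.range f) := this ▸ Set.mem_univ x
    rcases hx with hx | ⟨a, rfl⟩
    · exact Or.inl hx
    · exact Or.inr ⟨a, rfl⟩
  constructor
  · rintro ⟨h1, h2⟩
    refine hσ.not_corner hn p fun x y hx hy => ?_
    obtain ⟨a, rfl⟩ := (huniv x).resolve_left hx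
    obtain ⟨b, rfl⟩ := (huniv y).resolve_left hy
    have ha := a.2
    have hb := b.2
    have ha' := π.val_apply_lt a
    have hb' := π.val_apply_lt b
    constructor
    · rw [h.pos, h.pos]; omega
    · rw [h.val, h.val]; omega
  · rintro a ⟨h1, h2⟩
    refine hσ.not_indist_pair hn (a := f a) (b := p) (fun e => h.notMem ⟨a, e⟩) fun x hx hy => ?_
    obtain ⟨c, rfl⟩ := (huniv x).resolve_left hy
    have hca : c ≠ a := fun e => hx (e ▸ rfl)
    have hca' : (c : ℕ) ≠ a := fun e => hca (Fin.ext e)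
    have hca'' : (π.2 c : ℕ) ≠ π.2 a := fun e => hca (eq_of_val_eq e)
    constructor
    · rw [h.lt_pos, hf.1.lt_iff_lt, Fin.lt_def]; omega
    · rw [h.lt_val, ← hf.2, Fin.lt_def]; omega

lemma IsSlot.hasExtension {π σ : FinPerm} (hπ : π.IsSimple) (hn : 2 ≤ π.size)
    {f : Fin π.size → Fin σ.size} (hf : IsEmbedding π σ f) {p : Fin σ.size} {i j : ℕ}
    (h : IsSlot π σ f p i j) (hg : IsGoodSlot π i j) : HasExtension π σ := by
  by_contra hno
  have hX : σ.SimpleOn (Set.range f) := hf.simpleOn_range_iff.2 hπ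
  have hi := h.le_pos
  have hj := h.le_val
  rcases hX.corner_or_twin h.notMem (fun hs => hno (hf.hasExtension h.notMem hs)) with
    hc | ⟨_, ⟨a, rfl⟩, hc⟩
  · have key : ∀ a b, σ.Indist p (f a) (f b) := fun a b =>
      hc.2 p (by simp) h.notMem _ ⟨a, rfl⟩ _ ⟨b, rfl⟩
    apply hg.1
    have h1 := (key ⟨0, by omega⟩ ⟨π.size - 1, by omega⟩).1
    have h2 := (key (π.2.symm (⟨0, by omega⟩ : Fin π.size))
      (π.2.symm (⟨π.size - 1, by omega⟩ : Fin π.size))).2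
    rw [h.pos, h.pos] at h1
    rw [h.val, h.val, Equiv.apply_symm_apply, Equiv.apply_symm_apply] at h2
    simp only at h1 h2
    omega
  · have key : ∀ c, c ≠ a → σ.Indist (f c) (f a) p := fun c hca =>
      hc.2 (f c) (Or.inr ⟨c, rfl⟩) (by
        simp only [Set.mem_insert_iff, Set.mem_singleton_iff, not_or]
        exact ⟨fun e => hca (hf.1.injective e), fun e => h.notMem ⟨c, e⟩⟩) _ (by simp) _ (by simp)
    have ha := a.2
    have ha' := π.val_apply_lt a
    refine hg.2 a ⟨?_, ?_⟩
    · by_contra hcon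
      have key' : ∀ k, k < π.size → k ≠ (a : ℕ) → (k < (a : ℕ) ↔ k < i) := by
        intro k hk hka
        have := (key ⟨k, hk⟩ (fun e => hka (by rw [← e]))).1
        rwa [h.lt_pos, hf.1.lt_iff_lt, Fin.lt_def] at this
      rcases Nat.lt_or_ge i a with h1 | h1
      · have := key' i (by omega) (by omega)
        omega
      · have := key' (a + 1) (by omega) (by omega)
        omega
    · by_contra hcon
      have key' : ∀ k, k < π.size → k ≠ (π.2 a : ℕ) → (k < (π.2 a : ℕ) ↔ k < j) := by
        intro k hk hka
        obtain ⟨c, rfl⟩ := π.exists_val_eq hk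
        have := (key c (fun e => hka (by rw [e]))).2
        rwa [h.lt_val, ← hf.2, Fin.lt_def] at this
      rcases Nat.lt_or_ge j (π.2 a) with h1 | h1
      · have := key' j (by omega) (by omega)
        omega
      · have := key' (π.2 a + 1) (by omega) (by omega)
        omega

/-- The column or row that contains column or row `i` after the lines `a < b` are deleted. -/
def contract (a b i : ℕ) : ℕ := if i ≤ a then i else if i ≤ b then i - 1 else i - 2

lemma IsSlot.contract {m c d : ℕ} (hd : d ≤ m) (hcd : c ≤ d) (hdc : d ≤ c + 1) {σ : FinPerm}
    {f : Fin (typeOne (m + 1)).size → Fin σ.size} (hf : IsEmbedding (typeOne (m + 1)) σ f)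
    {p : Fin σ.size} {i j : ℕ} (h : IsSlot (typeOne (m + 1)) σ f p i j) :
    ∃ g, IsEmbedding (typeOne m) σ g ∧ IsSlot (typeOne m) σ g p
      (FinPerm.contract c (m + 1 + d) i) (FinPerm.contract (c + d) (c + d + 1) j) := by
  obtain ⟨g, hg, -, hgp, hgv⟩ := isEmbedding_typeOne_succ hd hcd hdc
  have hi : i ≤ 2 * (m + 1) := h.le_pos
  have hj : j ≤ 2 * (m + 1) := h.le_val
  refine ⟨_, hf.comp hg, fun ⟨a, ha⟩ => h.notMem ⟨g a, ha⟩, ?_, ?_, fun a => ?_, fun a => ?_⟩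
  · change _ ≤ 2 * m
    unfold FinPerm.contract
    split_ifs <;> omega
  · change _ ≤ 2 * m
    unfold FinPerm.contract
    split_ifs <;> omega
  · refine (h.pos (g a)).trans ?_
    rw [hgp]
    unfold FinPerm.contract
    split_ifs <;> omega
  · refine (h.val (g a)).trans ?_
    rw [hgv]
    unfold FinPerm.contract
    split_ifs <;> omega

/-- `IsGoodSlot` for `typeOne m`, spelled out in natural numbers. -/
def IsGoodPair (m i j : ℕ) : Prop :=
  ¬ ((i = 0 ∨ i = 2 * m) ∧ (j = 0 ∨ j = 2 * m)) ∧
    ∀ a < 2 * m, ¬ ((i = a ∨ i = a + 1) ∧ (j = (if a < m then 2 * a + 1 else 2 * a - 2 * m) ∨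
      j = (if a < m then 2 * a + 1 else 2 * a - 2 * m) + 1))

instance (m i j : ℕ) : Decidable (IsGoodPair m i j) := by
  unfold IsGoodPair
  infer_instance

lemma isGoodSlot_typeOne_iff {m i j : ℕ} : IsGoodSlot (typeOne m) i j ↔ IsGoodPair m i j := by
  unfold IsGoodSlot IsGoodPair
  simp only [typeOne_apply]
  exact and_congr Iff.rfl ⟨fun h a ha => h ⟨a, ha⟩, fun h a => h a a.2⟩

lemma isGoodPair_iff {m i j : ℕ} : IsGoodPair m i j ↔
    ¬ ((i = 0 ∨ i = 2 * m) ∧ (j = 0 ∨ j = 2 * m)) ∧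
    (∀ a < m, ¬ ((i = a ∨ i = a + 1) ∧ (j = 2 * a + 1 ∨ j = 2 * a + 2))) ∧
    ∀ b < m, ¬ ((i = m + b ∨ i = m + b + 1) ∧ (j = 2 * b ∨ j = 2 * b + 1)) := by
  unfold IsGoodPair
  refine and_congr Iff.rfl ⟨fun h => ⟨fun a ha => ?_, fun b hb => ?_⟩, fun h a ha => ?_⟩
  · have := h a (by omega)
    rw [if_pos ha] at this
    omega
  · have := h (m + b) (by omega)
    rw [if_neg (by omega)] at this
    omega
  · split_ifs with h'
    · have := h.1 a h'
      omega
    · have := h.2 (a - m) (by omega)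
      omega

/-- The good slots that are spoilt by deleting the two smallest values of `typeOne (m + 1)`. -/
lemma IsGoodPair.eq_of_not_contract_low {m i j : ℕ} (hi : i ≤ 2 * (m + 1)) (hj : j ≤ 2 * (m + 1))
    (h : IsGoodPair (m + 1) i j)
    (hc : ¬ IsGoodPair m (FinPerm.contract 0 (m + 1) i) (FinPerm.contract 0 1 j)) :
    (i = 0 ∧ (j = 3 ∨ j = 4)) ∨ (i = m + 2 ∧ (j = 2 * m + 1 ∨ j = 2 * m + 2)) ∨
      (i = m + 1 ∧ (j = 2 ∨ j = 3)) ∨ (i = m + 3 ∧ (j = 0 ∨ j = 1)) ∨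
      (i = 1 ∧ (j = 0 ∨ j = 2 * m + 2)) ∨ (i = 2 * m + 2 ∧ (j = 1 ∨ j = 2)) := by
  rw [isGoodPair_iff] at h hc
  obtain ⟨h0, hl, hr⟩ := h
  unfold FinPerm.contract at hc
  by_contra hcon
  apply hc
  have hl0 := hl 0 (by omega)
  have hr0 := hr 0 (by omega)
  refine ⟨fun hx => ?_, fun a ha hx => ?_, fun b hb hx => ?_⟩
  · clear hl hr
    split_ifs at hx <;> omega
  · have := hl (a + 1) (by omega)
    clear hl hr
    split_ifs at hx <;> omega
  · have := hr (b + 1) (by omega)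
    clear hl hr
    split_ifs at hx <;> omega

/-- The good slots that are spoilt by deleting the two largest values of `typeOne (m + 1)`. -/
lemma IsGoodPair.eq_of_not_contract_high {m i j : ℕ} (hi : i ≤ 2 * (m + 1)) (hj : j ≤ 2 * (m + 1))
    (h : IsGoodPair (m + 1) i j)
    (hc : ¬ IsGoodPair m (FinPerm.contract m (m + 1 + m) i)
      (FinPerm.contract (m + m) (m + m + 1) j)) :
    (i = 2 * m + 2 ∧ (j + 1 = 2 * m ∨ j + 2 = 2 * m)) ∨ (i = m ∧ (j = 0 ∨ j = 1)) ∨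
      (i = m + 1 ∧ (j = 2 * m ∨ j + 1 = 2 * m)) ∨
      (i + 1 = m ∧ (j = 2 * m + 1 ∨ j = 2 * m + 2)) ∨
      (i = 2 * m + 1 ∧ (j = 0 ∨ j = 2 * m + 2)) ∨ (i = 0 ∧ (j = 2 * m ∨ j = 2 * m + 1)) := by
  rw [isGoodPair_iff] at h hc
  obtain ⟨h0, hl, hr⟩ := h
  unfold FinPerm.contract at hc
  by_contra hcon
  apply hc
  have hl0 := hl m (by omega)
  have hr0 := hr m (by omega)
  refine ⟨fun hx => ?_, fun a ha hx => ?_, fun b hb hx => ?_⟩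
  · clear hl hr
    split_ifs at hx <;> omega
  · have := hl a (by omega)
    clear hl hr
    split_ifs at hx <;> omega
  · have := hr b (by omega)
    clear hl hr
    split_ifs at hx <;> omega

/-- For `m = 2` there are two good slots that no deletion of this kind keeps good. -/
lemma IsGoodPair.contract_two : ∀ i j : Fin 7, IsGoodPair 3 i j →
    (i = 1 ∧ j = 6) ∨ (i = 5 ∧ j = 0) ∨ ∃ c d : Fin 3, c ≤ d ∧ (d : ℕ) ≤ c + 1 ∧
      IsGoodPair 2 (FinPerm.contract c (3 + d) i) (FinPerm.contract (c + d) (c + d + 1) j) := by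
  decide +kernel

/-- Five points of `σ` that form the pattern `2 5 3 1 4`, which becomes `2 4 1 3` without its
middle point `p`. -/
lemma hasExtension_typeOne_two {σ : FinPerm} (hs : (typeOne 2).IsSimple) {x₀ x₁ p x₂ x₃ : Fin σ.size}
    (h0 : x₀ < x₁) (h1 : x₁ < p) (h2 : p < x₂) (h3 : x₂ < x₃) (v0 : σ.2 x₂ < σ.2 x₀)
    (v1 : σ.2 x₀ < σ.2 p) (v2 : σ.2 p < σ.2 x₃) (v3 : σ.2 x₃ < σ.2 x₁) :
    HasExtension (typeOne 2) σ := by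
  let f : Fin 4 → Fin σ.size := ![x₀, x₁, x₂, x₃]
  have t0 : (typeOne 2).2 (0 : Fin 4) = (1 : Fin 4) := rfl
  have t1 : (typeOne 2).2 (1 : Fin 4) = (3 : Fin 4) := rfl
  have t2 : (typeOne 2).2 (2 : Fin 4) = (0 : Fin 4) := rfl
  have t3 : (typeOne 2).2 (3 : Fin 4) = (2 : Fin 4) := rfl
  have hf : IsEmbedding (typeOne 2) σ f := by
    refine ⟨?_, ?_⟩
    · change StrictMono f
      rw [Fin.strictMono_iff_lt_succ]
      intro i
      fin_cases i
      exacts [h0, h1.trans h2, h3]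
    · change ∀ a b : Fin 4, _
      intro a b
      fin_cases a <;> fin_cases b <;> simp [f, t0, t1, t2, t3] <;> order
  have hslot : IsSlot (typeOne 2) σ f p 2 2 := by
    refine ⟨?_, by decide, by decide, ?_, ?_⟩
    · rintro ⟨a, ha⟩
      change Fin 4 at a
      change f a = p at ha
      fin_cases a <;> simp [f] at ha <;> order
    · change ∀ a : Fin 4, _
      intro a
      fin_cases a <;> simp [f] <;> order
    · change ∀ a : Fin 4, _
      intro a
      fin_cases a <;> simp [f, t0, t1, t2, t3] <;> order
  exact hslot.hasExtension hs (by decide) hf (isGoodSlot_typeOne_iff.2 (by decide))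

/-- A simple one-point extension of an exceptional permutation contains a simple one-point extension
of the next smaller exceptional permutation of the same type. -/
theorem hasExtension_typeOne_of_succ {m : ℕ} (hm : 2 ≤ m) {σ : FinPerm} (hσ : σ.IsSimple)
    (hT : (typeOne m).IsSimple) (hs : σ.size = (typeOne (m + 1)).size + 1)
    (hp : (typeOne (m + 1)).IsPattern σ) : HasExtension (typeOne m) σ := by
  obtain ⟨f, hf⟩ := hp
  replace hf : IsEmbedding (typeOne (m + 1)) σ f := hf
  have hsize : (typeOne (m + 1)).size = 2 * (m + 1) := rfl
  have hsize' : (typeOne m).size = 2 * m := rfl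
  obtain ⟨p, hp⟩ : ∃ p, p ∉ Set.range f := by
    by_contra! hcon
    have := hf.ncard_range
    rw [Set.eq_univ_of_forall hcon, Set.ncard_univ, Nat.card_fin] at this
    omega
  obtain ⟨i, j, hij⟩ := hf.exists_isSlot hp
  have hgood := isGoodSlot_typeOne_iff.1 (hij.isGoodSlot hσ (by omega) hf hs)
  have hi : i ≤ 2 * (m + 1) := hij.le_pos
  have hj : j ≤ 2 * (m + 1) := hij.le_val
  have key : ∀ c d, d ≤ m → c ≤ d → d ≤ c + 1 →
      IsGoodPair m (contract c (m + 1 + d) i) (contract (c + d) (c + d + 1) j) →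
      HasExtension (typeOne m) σ := by
    intro c d h1 h2 h3 h4
    obtain ⟨g, hg, hslot⟩ := hij.contract h1 h2 h3 hf
    exact hslot.hasExtension hT (by omega) hg (isGoodSlot_typeOne_iff.2 h4)
  rcases Nat.lt_or_ge 2 m with hm3 | hm2
  · by_contra hno
    have h1 := hgood.eq_of_not_contract_low hi hj
      (fun h => hno (key 0 0 (by omega) le_rfl (by omega) (by simpa using h)))
    have h2 := hgood.eq_of_not_contract_high hi hj
      (fun h => hno (key m m le_rfl le_rfl (by omega) h))
    omega
  · obtain rfl : m = 2 := by omega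
    have hv : ∀ a : Fin 6, ((typeOne 3).2 a : ℕ) = ![1, 3, 5, 0, 2, 4] a := by decide
    have hlt : ∀ a b : Fin 6, a < b → f a < f b := fun a b h => hf.1 h
    have hlt' : ∀ a b : Fin 6, (![1, 3, 5, 0, 2, 4] a : ℕ) < ![1, 3, 5, 0, 2, 4] b →
        σ.2 (f a) < σ.2 (f b) := fun a b h => (hf.2 a b).1 (by
          rw [Fin.lt_def]; exact (hv a).trans_lt (h.trans_eq (hv b).symm))
    have p1 : ∀ a : Fin 6, i ≤ a → p < f a := fun a => (hij.pos a).2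
    have p2 : ∀ a : Fin 6, (a : ℕ) < i → f a < p := fun a => (hij.lt_pos a).2
    have p3 : ∀ a : Fin 6, j ≤ (![1, 3, 5, 0, 2, 4] a : ℕ) → σ.2 p < σ.2 (f a) := fun a h =>
      (hij.val a).2 (h.trans_eq (hv a).symm)
    have p4 : ∀ a : Fin 6, (![1, 3, 5, 0, 2, 4] a : ℕ) < j → σ.2 (f a) < σ.2 p := fun a h =>
      (hij.lt_val a).2 ((hv a).trans_lt h)
    rcases IsGoodPair.contract_two ⟨i, by omega⟩ ⟨j, by omega⟩ hgood with
      ⟨h1, h2⟩ | ⟨h1, h2⟩ | ⟨c, d, h1, h2, h3⟩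
    · obtain rfl : i = 1 := congrArg Fin.val h1
      obtain rfl : j = 6 := congrArg Fin.val h2
      exact hasExtension_typeOne_two hT (x₀ := f (0 : Fin 6)) (x₁ := p) (p := f (1 : Fin 6))
        (x₂ := f (3 : Fin 6)) (x₃ := f (5 : Fin 6)) (p2 _ (by decide)) (p1 _ (by decide))
        (hlt _ _ (by decide)) (hlt _ _ (by decide)) (hlt' _ _ (by decide)) (hlt' _ _ (by decide))
        (hlt' _ _ (by decide)) (p4 _ (by decide))
    · obtain rfl : i = 5 := congrArg Fin.val h1
      obtain rfl : j = 0 := congrArg Fin.val h2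
      exact hasExtension_typeOne_two hT (x₀ := f (0 : Fin 6)) (x₁ := f (2 : Fin 6))
        (p := f (4 : Fin 6)) (x₂ := p) (x₃ := f (5 : Fin 6)) (hlt _ _ (by decide))
        (hlt _ _ (by decide)) (p2 _ (by decide)) (p1 _ (by decide)) (p3 _ (by decide))
        (hlt' _ _ (by decide)) (hlt' _ _ (by decide)) (hlt' _ _ (by decide))
    · have hd := d.2
      exact key c d (by omega) h1 h2 h3

/-! ### Chains of simple permutations -/

lemma HasExtension.trans {π τ σ : FinPerm} (h : HasExtension π τ) (h' : τ.IsPattern σ) :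
    HasExtension π σ := by
  obtain ⟨ρ, h1, h2, h3, h4⟩ := h
  exact ⟨ρ, h1, h2, h3.trans h', h4⟩

/-- If `π` has no simple one-point extension in the simple `σ`, then it has a simple two-point
extension there, and both are exceptional of the same type. -/
theorem IsPattern.exists_two_point_extension {π σ : FinPerm} (hπ : π.IsSimple) (hσ : σ.IsSimple)
    (h3 : 3 ≤ π.size) (hp : π.IsPattern σ) (hlt : π.size < σ.size) (hno : ¬ HasExtension π σ) :
    ∃ τ : FinPerm, τ.IsSimple ∧ τ.IsPattern σ ∧ ∃ g, IsDihedral g ∧ ∃ m, 2 ≤ m ∧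
      g τ = typeOne (m + 1) ∧ g π = typeOne m := by
  obtain ⟨f, hf⟩ := hp
  replace hf : IsEmbedding π σ f := hf
  have hcard := hf.ncard_range
  have hX3 : ∀ a b, ∃ c ∈ Set.range f, c ≠ a ∧ c ≠ b := by
    intro a b
    by_contra! hcon
    have hsub : Set.range f ⊆ {a, b} := fun c hc => by
      by_cases hca : c = a
      · exact Or.inl hca
      · exact Or.inr (hcon c hc hca)
    have h1 := Set.ncard_le_ncard hsub
    have h2 := Set.ncard_insert_le a {b}
    rw [Set.ncard_singleton] at h2
    omega
  have hne : Set.range f ≠ Set.univ := fun h => by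
    rw [h, Set.ncard_univ, Nat.card_fin] at hcard
    omega
  rcases SimpleOn.exists_extension ((isSimple_iff_simpleOn_univ σ).1 hσ)
    (hf.simpleOn_range_iff.2 hπ) hX3 hne with ⟨v, hv, hs⟩ | ⟨v, hv, w, hw, hvw, hs⟩
  · exact absurd (hf.hasExtension hv hs) hno
  · obtain ⟨τ, k, hk, hkr⟩ := exists_isEmbedding_range_eq σ (insert v (insert w (Set.range f)))
    obtain ⟨l, hl, -⟩ := hf.isPattern_of_range_subset hk
      (by rw [hkr]; exact (Set.subset_insert _ _).trans (Set.subset_insert _ _))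
    have hτ : τ.IsSimple := hk.simpleOn_range_iff.1 (hkr ▸ hs)
    have hsize : τ.size = π.size + 2 := by
      rw [← hk.ncard_range, hkr, Set.ncard_insert_of_notMem (by simpa [hvw] using hv),
        Set.ncard_insert_of_notMem hw, hcard]
    have hτσ : τ.IsPattern σ := ⟨k, hk⟩
    have hπτ : π.IsPattern τ := ⟨l, hl⟩
    exact ⟨τ, hτ, hτσ, hπτ.exists_dihedral_typeOne hπ hτ h3 hsize fun h => hno (h.trans hτσ)⟩

/-- Suppose `σ` is simple, is not itself of type 1, and contains `typeOne (m + 1)` but no simple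
one-point extension of `typeOne m`. Then it contains every larger permutation of type 1: a
one-point extension of any of them would contain one of `typeOne m`, so each step up is a two-point
extension, of the same type. -/
lemma isPattern_typeOne_add {σ : FinPerm} (hσ : σ.IsSimple) {m : ℕ} (hm : 2 ≤ m)
    (hne : ∀ k, 2 ≤ k → σ ≠ typeOne k) (h0 : (typeOne m).IsSimple)
    (h1 : (typeOne (m + 1)).IsSimple) (hp : (typeOne (m + 1)).IsPattern σ)
    (hno : ¬ HasExtension (typeOne m) σ) (d : ℕ) :
    (typeOne (m + d)).IsSimple ∧ (typeOne (m + d)).IsPattern σ ∧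
      ¬ HasExtension (typeOne (m + d)) σ := by
  have hsub : ∀ k, (typeOne k).IsPattern (typeOne (k + 1)) := fun k => by
    obtain ⟨f, hf, -⟩ := isEmbedding_typeOne_succ (m := k) (c := 0) (d := 0) (by omega) le_rfl
      (by omega)
    exact ⟨f, hf⟩
  have hsize : ∀ k, (typeOne k).size = 2 * k := fun _ => rfl
  induction d with
  | zero => exact ⟨h0, (hsub m).trans hp, hno⟩
  | succ d ih =>
    obtain ⟨hs, hpd, hnod⟩ := ih
    have hnext : (typeOne (m + d + 1)).IsSimple ∧ (typeOne (m + d + 1)).IsPattern σ := by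
      rcases Nat.eq_zero_or_pos d with rfl | hd
      · exact ⟨h1, hp⟩
      · have hlt : (typeOne (m + d)).size < σ.size := by
          refine lt_of_le_of_ne hpd.size_le fun h => ?_
          exact hne (m + d) (by omega) (hpd.eq_of_size_eq h).symm
        obtain ⟨τ, hτ, hτσ, g, hg, k, hk, hgτ, hgm⟩ :=
          hpd.exists_two_point_extension hs hσ (by rw [hsize]; omega) hlt hnod
        have hkm : k = m + d := by
          have := congrArg FinPerm.size hgm
          rw [hg.size_eq, hsize, hsize] at this
          omega
        subst hkm
        -- `g` fixes `typeOne (m + d)`, of size at least 6, hence also `typeOne (m + d + 1)`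
        have hfix := hg.apply_typeOne_eq (by omega) hgm (m + d + 1)
        obtain ⟨g', -, hg', -⟩ := hg.exists_inverse
        have : τ = typeOne (m + d + 1) := by rw [← hg' τ, hgτ, ← hfix, hg', hfix]
        subst this
        exact ⟨hτ, hτσ⟩
    refine ⟨hnext.1, hnext.2, ?_⟩
    rintro ⟨ρ, hρ, h2, h3, h4⟩
    exact hnod ((hasExtension_typeOne_of_succ (by omega) hρ hs h4 h2).trans h3)

/-- Below a simple permutation that is not exceptional, every proper simple pattern has a simple
one-point extension. -/
theorem IsPattern.hasExtension {π σ : FinPerm} (hπ : π.IsSimple) (hσ : σ.IsSimple)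
    (h3 : 3 ≤ π.size) (hexc : ¬ σ.IsExceptional) (hp : π.IsPattern σ) (hlt : π.size < σ.size) :
    HasExtension π σ := by
  by_contra hno
  obtain ⟨τ, hτ, hτσ, g, hg, m, hm, hgτ, hgπ⟩ :=
    hp.exists_two_point_extension hπ hσ h3 hlt hno
  obtain ⟨g', hg', hinv, -⟩ := hg.exists_inverse
  have hne : ∀ k, 2 ≤ k → g σ ≠ typeOne k := fun k hk h => hexc (by
    rw [← hinv σ, h]
    exact hg'.isExceptional hk)
  have hno' : ¬ HasExtension (typeOne m) (g σ) := fun h => hno (by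
    have := hg'.hasExtension h
    rwa [hinv, ← hgπ, hinv] at this)
  have hall := isPattern_typeOne_add (hg.isSimple hσ) hm hne (hgπ ▸ hg.isSimple hπ)
    (hgτ ▸ hg.isSimple hτ) (hgτ ▸ hg.isPattern hτσ) hno' (g σ).size
  have hle := hall.2.1.size_le
  rw [typeOne_size] at hle
  omega

/-- The chain is built from below, by repeated one-point extensions of `π` inside `σ`. -/
theorem exists_chain_of_isPattern {σ : FinPerm} (hσ : σ.IsSimple) (hexc : ¬ σ.IsExceptional)
    (l : ℕ) : ∀ π : FinPerm, π.IsSimple → 3 ≤ π.size → π.IsPattern σ → σ.size = π.size + l →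
    ∃ s : Fin (l + 1) → FinPerm, s 0 = σ ∧ s (Fin.last l) = π ∧ (∀ i, (s i).IsSimple) ∧
      ∀ i : Fin l, (s i.succ).IsPattern (s i.castSucc) ∧
        (s i.castSucc).size = (s i.succ).size + 1 := by
  induction l with
  | zero =>
    intro π hπ _ hp hs
    obtain rfl : π = σ := hp.eq_of_size_eq hs.symm
    exact ⟨fun _ => π, rfl, rfl, fun _ => hπ, fun i => i.elim0⟩
  | succ l ih =>
    intro π hπ h3 hp hs
    obtain ⟨τ, hτ, hπτ, hτσ, hsize⟩ := hp.hasExtension hπ hσ h3 hexc (by omega)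
    obtain ⟨s, h0, hl, hsimple, hstep⟩ := ih τ hτ (by omega) hτσ (by omega)
    refine ⟨Fin.snoc (α := fun _ => FinPerm) s π, ?_, ?_, ?_, ?_⟩
    · rw [← Fin.castSucc_zero, Fin.snoc_castSucc, h0]
    · rw [Fin.snoc_last]
    · intro i
      refine Fin.lastCases ?_ (fun i => ?_) i
      · rwa [Fin.snoc_last]
      · rw [Fin.snoc_castSucc]; exact hsimple i
    · intro i
      refine Fin.lastCases ?_ (fun i => ?_) i
      · rw [Fin.snoc_castSucc, Fin.succ_last, Fin.snoc_last, hl]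
        exact ⟨hπτ, hsize⟩
      · rw [Fin.snoc_castSucc, Fin.succ_castSucc, Fin.snoc_castSucc]
        exact hstep i

end FinPerm

theorem mainTheorem1 (σ π : FinPerm) (hσ : σ.IsSimple) (hπ : π.IsSimple) (hne : σ ≠ π)
    (hexc : ¬ σ.IsExceptional) (hpat : π.IsPattern σ) (hsize : 3 ≤ π.size) :
    ∃ (l : ℕ) (s : Fin (l + 1) → FinPerm),
      σ.size = π.size + l ∧
      s 0 = σ ∧ s (Fin.last l) = π ∧
      (∀ i : Fin (l + 1), (s i).IsSimple) ∧
      ∀ i : Fin l, (s i.succ).IsPattern (s i.castSucc) ∧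
        (s i.castSucc).size = (s i.succ).size + 1 := by
  have hs : σ.size = π.size + (σ.size - π.size) := by
    have := hpat.size_le
    omega
  obtain ⟨s, h⟩ := FinPerm.exists_chain_of_isPattern hσ hexc _ π hπ hsize hpat hs
  exact ⟨_, s, hs, h⟩
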